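/- Theorem. For a clustering (partition into nonempty clusters) $\mathcal C$ of a finite set $V$, write $u\sim_{\mathcal C}v$ if $u,v$ lie in the same cluster, and let $\mathrm{dist}(\mathcal C,\mathcal D)$ be the number of unordered pairs $\{u,v\}\subseteq V$ for which exactly one of $u\sim_{\mathcal C}v$, $u\sim_{\mathcal D}v$ holds. If every vertex of $V$ is coloured red or blue, a clustering $\mathcal F$ is called fair if in each of its clusters the ratio of blue to red vertices equals the ratio of blue to red vertices in $V$. A fair clustering $\mathcal F$ is called $\alpha$-close to $\mathcal C$ if $\mathrm{dist}(\mathcal C,\mathcal F)\le\alpha\cdot\mathrm{dist}(\mathcal C,\mathcal F^*)$, where $\mathcal F^*$ is a fair clustering of $V$ at minimum distance from $\mathcal C$. There is a deterministic algorithm with running time polynomial in $|V|$ which, given a vertex set $V$ partitioned into blue and red vertices whose ratio is $p:1$ for some integer $p>1$, together with an arbitrary clustering $\mathcal C$ of $V$, outputs a $17$-close fair clustering to $\mathcal C$. -/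

import Mathlib

/-! ## Clusterings, distance, fairness -/

section Clusterings

variable {V χ : Type*} [Fintype V] [DecidableEq V] [DecidableEq χ]

/-- A clustering of the finite vertex set `V`: a partition of `V` into nonempty clusters. -/
abbrev Clustering (V : Type*) [Fintype V] [DecidableEq V] : Type _ :=
  Finpartition (Finset.univ : Finset V)

/-- `u` and `v` belong to the same cluster of `C`. -/
def SameCluster (C : Clustering V) (u v : V) : Prop :=
  ∃ S ∈ C.parts, u ∈ S ∧ v ∈ S

/-- The number of unordered pairs `{u, v}` that are together in exactly one of `C` and `D`. -/
noncomputable def clusterDist (C D : Clustering V) : ℕ :=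
  {e : Sym2 V | ∃ u v : V, e = s(u, v) ∧
    ((SameCluster C u v ∧ ¬ SameCluster D u v) ∨
      (¬ SameCluster C u v ∧ SameCluster D u v))}.ncard

/-- The number of vertices of colour `c` in `S`. -/
def colourCount (col : V → χ) (c : χ) (S : Finset V) : ℕ :=
  (S.filter fun v => col v = c).card

/-- In every cluster, the numbers of vertices of the various colours are in the same ratio as in
the whole vertex set (equality of ratios is written by cross-multiplication). -/
def IsFair (col : V → χ) (F : Clustering V) : Prop :=
  ∀ S ∈ F.parts, ∀ c c' : χ,
    colourCount col c S * colourCount col c' Finset.univ =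
      colourCount col c' S * colourCount col c Finset.univ

/-- `F` is a fair clustering at minimum distance from `C` among all fair clusterings. -/
def IsClosestFair (col : V → χ) (C F : Clustering V) : Prop :=
  IsFair col F ∧ ∀ F' : Clustering V, IsFair col F' → clusterDist C F ≤ clusterDist C F'

/-- `F` is an `α`-close fair clustering to `C`. -/
def IsCloseFair (α : ℝ) (col : V → χ) (C F : Clustering V) : Prop :=
  IsFair col F ∧ ∃ Fopt : Clustering V, IsClosestFair col C Fopt ∧
    (clusterDist C F : ℝ) ≤ α * (clusterDist C Fopt : ℝ)

end Clusterings

/-- The two colours. -/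
inductive Colour where
  | red
  | blue
  deriving DecidableEq

/-! ## A random access machine with unit costs

The memory consists of registers `var 0, var 1, …` and of arrays `arr 0, arr 1, …` with unbounded
index range, all holding natural numbers; a program mentions finitely many registers and arrays,
and arrays are accessed at computed indices.  The arithmetic operations are addition and truncated
subtraction (no multiplication, so that the unit-cost measure is polynomially equivalent to
Turing machine time). -/

namespace RAM

/-- Memory contents. -/
structure Store where
  var : ℕ → ℕ
  arr : ℕ → ℕ → ℕ

/-- Arithmetic expressions. -/
inductive Expr where
  | lit (k : ℕ)
  | var (x : ℕ)
  | get (a : ℕ) (i : Expr)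
  | add (e f : Expr)
  | sub (e f : Expr)

/-- Tests. -/
inductive Test where
  | eq (e f : Expr)
  | lt (e f : Expr)
  | not (b : Test)
  | and (b c : Test)

/-- Programs. -/
inductive Program where
  | skip
  | assign (x : ℕ) (e : Expr)
  | put (a : ℕ) (i e : Expr)
  | seq (P Q : Program)
  | branch (b : Test) (P Q : Program)
  | loop (b : Test) (P : Program)

/-- The value of an expression. -/
def Expr.eval (s : Store) : Expr → ℕ
  | .lit k => k
  | .var x => s.var x
  | .get a i => s.arr a (i.eval s)
  | .add e f => e.eval s + f.eval s
  | .sub e f => e.eval s - f.eval s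

/-- Evaluating an expression costs one step for each of its operations. -/
def Expr.cost : Expr → ℕ
  | .lit _ => 1
  | .var _ => 1
  | .get _ i => i.cost + 1
  | .add e f => e.cost + f.cost + 1
  | .sub e f => e.cost + f.cost + 1

/-- The truth value of a test. -/
def Test.eval (s : Store) : Test → Bool
  | .eq e f => decide (e.eval s = f.eval s)
  | .lt e f => decide (e.eval s < f.eval s)
  | .not b => !(b.eval s)
  | .and b c => b.eval s && c.eval s

/-- Evaluating a test costs one step for each of its operations. -/
def Test.cost : Test → ℕ
  | .eq e f => e.cost + f.cost + 1
  | .lt e f => e.cost + f.cost + 1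
  | .not b => b.cost + 1
  | .and b c => b.cost + c.cost + 1

/-- Write `k` into register `x`. -/
def Store.setVar (s : Store) (x k : ℕ) : Store :=
  { s with var := Function.update s.var x k }

/-- Write `k` into cell `i` of array `a`. -/
def Store.setArr (s : Store) (a i k : ℕ) : Store :=
  { s with arr := Function.update s.arr a (Function.update (s.arr a) i k) }

/-- `Exec P s t s'`: the program `P`, started in memory `s`, halts after exactly `t` steps in
memory `s'`.  `loop b P` repeats `P` as long as `b` is true. -/
inductive Exec : Program → Store → ℕ → Store → Prop
  | skip (s : Store) : Exec .skip s 1 s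
  | assign (x : ℕ) (e : Expr) (s : Store) :
      Exec (.assign x e) s (e.cost + 1) (s.setVar x (e.eval s))
  | put (a : ℕ) (i e : Expr) (s : Store) :
      Exec (.put a i e) s (i.cost + e.cost + 1) (s.setArr a (i.eval s) (e.eval s))
  | seq {P Q : Program} {s s' s'' : Store} {t t' : ℕ} :
      Exec P s t s' → Exec Q s' t' s'' → Exec (.seq P Q) s (t + t') s''
  | branchTrue {b : Test} {P Q : Program} {s s' : Store} {t : ℕ} :
      b.eval s = true → Exec P s t s' → Exec (.branch b P Q) s (b.cost + 1 + t) s'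
  | branchFalse {b : Test} {P Q : Program} {s s' : Store} {t : ℕ} :
      b.eval s = false → Exec Q s t s' → Exec (.branch b P Q) s (b.cost + 1 + t) s'
  | loopDone {b : Test} {P : Program} {s : Store} :
      b.eval s = false → Exec (.loop b P) s (b.cost + 1) s
  | loopStep {b : Test} {P : Program} {s s' s'' : Store} {t t' : ℕ} :
      b.eval s = true → Exec P s t s' → Exec (.loop b P) s' t' s'' →
        Exec (.loop b P) s (b.cost + 1 + t + t') s''

/-- The machine is deterministic: running time and result are determined by program and input. -/
theorem Exec.deterministic {P : Program} {s s₁ s₂ : Store} {t₁ t₂ : ℕ}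
    (h₁ : Exec P s t₁ s₁) (h₂ : Exec P s t₂ s₂) : t₁ = t₂ ∧ s₁ = s₂ := by
  induction h₁ generalizing t₂ s₂ with
  | skip => cases h₂; exact ⟨rfl, rfl⟩
  | assign => cases h₂; exact ⟨rfl, rfl⟩
  | put => cases h₂; exact ⟨rfl, rfl⟩
  | seq _ _ ih ih' =>
    cases h₂ with
    | seq g g' =>
      obtain ⟨rfl, rfl⟩ := ih g
      obtain ⟨rfl, rfl⟩ := ih' g'
      exact ⟨rfl, rfl⟩
  | branchTrue hb _ ih =>
    cases h₂ with
    | branchTrue _ g => obtain ⟨rfl, rfl⟩ := ih g; exact ⟨rfl, rfl⟩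
    | branchFalse hc _ => simp [hb] at hc
  | branchFalse hb _ ih =>
    cases h₂ with
    | branchTrue hc _ => simp [hb] at hc
    | branchFalse _ g => obtain ⟨rfl, rfl⟩ := ih g; exact ⟨rfl, rfl⟩
  | loopDone hb =>
    cases h₂ with
    | loopDone => exact ⟨rfl, rfl⟩
    | loopStep hc _ _ => simp [hb] at hc
  | loopStep hb _ _ ih ih' =>
    cases h₂ with
    | loopDone hc => simp [hb] at hc
    | loopStep _ g g' =>
      obtain ⟨rfl, rfl⟩ := ih g
      obtain ⟨rfl, rfl⟩ := ih' g'
      exact ⟨rfl, rfl⟩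

end RAM

/-! ## Input and output of clustering algorithms -/

/-- `lab` is a list of cluster labels from `{0, …, n - 1}` that describes the clustering `C`: two
vertices carry the same label exactly when they are in the same cluster. -/
def Labels {n : ℕ} (lab : Fin n → Fin n) (C : Clustering (Fin n)) : Prop :=
  ∀ u v : Fin n, lab u = lab v ↔ SameCluster C u v

/-- The initial memory on a coloured vertex set `{0, …, n - 1}` with cluster labels `lab`: register
`0` holds `n`, array `0` the colours (`0` for red and `1` for blue), array `1` the labels, and
everything else is `0`. -/
def inputStore {n : ℕ} (col : Fin n → Colour) (lab : Fin n → Fin n) : RAM.Store where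
  var x := if x = 0 then n else 0
  arr a i :=
    if h : i < n then
      if a = 0 then (if col ⟨i, h⟩ = Colour.blue then 1 else 0)
      else if a = 1 then (lab ⟨i, h⟩ : ℕ)
      else 0
    else 0

/-- The output in memory `s`, read off the first `n` cells of array `2`, is the clustering `F`,
given by labels from `{0, …, n - 1}`. -/
def Outputs {n : ℕ} (s : RAM.Store) (F : Clustering (Fin n)) : Prop :=
  ∃ lab : Fin n → Fin n, (∀ v : Fin n, s.arr 2 (v : ℕ) = (lab v : ℕ)) ∧ Labels lab F

/-! Let cluster `i` of the given clustering have `c i` vertices, of which `b i` are blue and `r i`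
red, let `P : 1` be the ratio of the colours and `s i = b i % P`. Call a cluster heavy if `P < 2 * s
i` and light otherwise. Distances are measured by `disagreement`, which counts ordered pairs and
sees a partition only through the fibres of a labelling.

Lower bound. In a fair clustering every cluster has a positive multiple of `P` blue vertices. So
each vertex of cluster `i` disagrees with at least `l i` others, where `l i` is the distance from `b
i` to the nearest positive multiple of `P`. Hence every fair clustering has disagreement at least `∑
c i * l i`.

Blue vertices. Rounding every `b i` down leaves a surplus that forces exactly `R - ∑ b i / P`
clusters to be rounded up, `R` being the number of red vertices. The algorithm takes the largest
heavy clusters, and opens new clusters when these run out. A linear programming duality argument,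
with one price per unit of residue, bounds the cost by `4 * ∑ c i * l i` (`sum_rounding_le`,
`disagreement_blue_le`).

Red vertices. With `P * k i` blue vertices in cluster `i`, the red vertices are redistributed so
that `k i` lie there. This costs at most `5 / 2` times the distance from the intermediate labelling
`m` to any fair clustering (`disagreement_red_le`).

If `d` is the optimal distance, `m` is within `4 * d` of the input and so within `5 * d` of the
optimum. The total is at most `(4 + 5 / 2 * 5) * d = 16.5 * d`, whence 17 (`disagreement_fill_le`).

The second half of the file implements this on the machine. `Runs` is a Hoare-style total
correctness predicate with a time bound; the repeated search for the largest heavy cluster accounts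
for the quadratic running time (`fairClustering_runs`). -/

/-! ## Disagreement of two labellings -/

section Disagreement

open Finset

variable {V α β γ : Type*} [Fintype V] [DecidableEq α] [DecidableEq β] [DecidableEq γ]

/-- The number of ordered pairs on which the partitions into fibres of `f` and of `g` differ. -/
def disagreement (f : V → α) (g : V → β) : ℕ :=
  ∑ v, #{u | ¬ (f u = f v ↔ g u = g v)}

theorem disagreement_comm (f : V → α) (g : V → β) : disagreement f g = disagreement g f := by
  unfold disagreement
  refine sum_congr rfl fun v _ => ?_
  congr 1
  ext u
  simp only [mem_filter, mem_univ, true_and]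
  tauto

theorem disagreement_triangle (f : V → α) (g : V → β) (h : V → γ) :
    disagreement f h ≤ disagreement f g + disagreement g h := by
  classical
  unfold disagreement
  rw [← sum_add_distrib]
  refine sum_le_sum fun v _ => (card_le_card ?_).trans (card_union_le _ _)
  intro u
  simp only [mem_filter, mem_univ, true_and, mem_union]
  tauto

/-- The separated pairs are the edges of a graph in which the degree of `v` is the summand of `v` in
`disagreement`, so this is the handshake lemma. -/
theorem two_mul_clusterDist [DecidableEq V] {C D : Clustering V} {f : V → α} {g : V → β}
    (hf : ∀ u v, f u = f v ↔ SameCluster C u v) (hg : ∀ u v, g u = g v ↔ SameCluster D u v) :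
    2 * clusterDist C D = disagreement f g := by
  classical
  let G : SimpleGraph V :=
    { Adj := fun u v => ¬ (f u = f v ↔ g u = g v)
      symm := ⟨fun u v h => by rwa [eq_comm (a := f v), eq_comm (a := g v)]⟩
      loopless := ⟨fun u h => by simp at h⟩ }
  have hset : {e : Sym2 V | ∃ u v : V, e = s(u, v) ∧
      ((SameCluster C u v ∧ ¬ SameCluster D u v) ∨
        (¬ SameCluster C u v ∧ SameCluster D u v))} = G.edgeSet := by
    ext e
    induction e with | _ a b
    simp only [Set.mem_ofPred_eq, SimpleGraph.mem_edgeSet]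
    constructor
    · rintro ⟨u, v, he, h⟩
      rw [← SimpleGraph.mem_edgeSet, he, SimpleGraph.mem_edgeSet]
      simp only [G, hf, hg]
      tauto
    · intro h
      refine ⟨a, b, rfl, ?_⟩
      simp only [G, hf, hg] at h
      tauto
  unfold clusterDist
  rw [hset, ← SimpleGraph.coe_edgeFinset, Set.ncard_coe_finset, ← G.sum_degrees_eq_twice_card_edges]
  unfold disagreement
  refine sum_congr rfl fun v _ => ?_
  rw [← SimpleGraph.card_neighborFinset_eq_degree]
  congr 1
  ext u
  simp only [SimpleGraph.mem_neighborFinset, mem_filter, mem_univ, true_and, G]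
  rw [eq_comm (a := f v), eq_comm (a := g v)]

/-- A labelling that agrees with `f` at many vertices is close to `f`. -/
theorem disagreement_le_sum (f g : V → ℕ) {N : ℕ} (hf : ∀ v, f v < N) (hg : ∀ v, g v < N) :
    (disagreement f g : ℤ) ≤ ∑ i ∈ range N,
      (((#{v | f v = i} : ℤ) ^ 2 - (#{v | f v = i ∧ g v = i} : ℤ) ^ 2) +
        ((#{v | g v = i} : ℤ) ^ 2 - (#{v | f v = i ∧ g v = i} : ℤ) ^ 2)) := by
  classical
  -- If `u`, `v` share the `a`-label `i` but differ under `b`, they cannot both keep the label `i`;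
  -- such pairs lie in a square of side the cluster minus the square of its kept part.
  have key : ∀ a b : V → ℕ, (∀ v, a v < N) →
      (∑ v, (#{u | a u = a v ∧ b u ≠ b v} : ℤ)) ≤
        ∑ i ∈ range N, ((#{v | a v = i} : ℤ) ^ 2 - (#{v | a v = i ∧ b v = i} : ℤ) ^ 2) := by
    intro a b ha
    rw [← sum_fiberwise_of_maps_to (s := univ) (t := range N) (g := a)
      (fun v _ => mem_range.2 (ha v))]
    refine sum_le_sum fun i _ => ?_
    have h1 : ∑ v ∈ univ.filter (fun v => a v = i), (#{u | a u = a v ∧ b u ≠ b v} : ℤ) =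
        (#((univ.filter fun v => a v = i).sigma fun v => univ.filter fun u =>
          a u = a v ∧ b u ≠ b v) : ℤ) := by
      rw [card_sigma]; push_cast; rfl
    have h2 : #((univ.filter fun v => a v = i).sigma fun v => univ.filter fun u =>
          a u = a v ∧ b u ≠ b v) ≤
        #(((univ.filter fun v => a v = i) ×ˢ (univ.filter fun v => a v = i)) \
          ((univ.filter fun v => a v = i ∧ b v = i) ×ˢ
            (univ.filter fun v => a v = i ∧ b v = i))) := by
      refine card_le_card_of_injOn (fun x => (x.1, x.2)) ?_ ?_
      · rintro ⟨v, u⟩ h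
        simp only [coe_sigma, Set.mem_sigma_iff, mem_coe, mem_filter, mem_univ, true_and] at h
        simp only [mem_coe, mem_sdiff, mem_product, mem_filter, mem_univ, true_and]
        refine ⟨⟨h.1, h.2.1.trans h.1⟩, ?_⟩
        rintro ⟨⟨_, h3⟩, _, h4⟩
        exact h.2.2 (h4.trans h3.symm)
      · rintro ⟨v, u⟩ _ ⟨v', u'⟩ _ h
        simp only [Prod.mk.injEq] at h
        obtain ⟨rfl, rfl⟩ := h
        rfl
    have hsub : (univ.filter fun v => a v = i ∧ b v = i) ⊆ univ.filter fun v => a v = i :=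
      fun v => by simp +contextual
    rw [h1]
    refine (Int.ofNat_le.2 h2).trans (le_of_eq ?_)
    have := card_sdiff_add_card_eq_card (product_subset_product hsub hsub)
    rw [card_product, card_product] at this
    have hz := congrArg (Nat.cast : ℕ → ℤ) this
    rw [Nat.cast_add, Nat.cast_mul, Nat.cast_mul] at hz
    linarith
  have h := add_le_add (key f g hf) (key g f hg)
  rw [← sum_add_distrib, ← sum_add_distrib] at h
  have hcomm : ∀ i, #{v | g v = i ∧ f v = i} = #{v | f v = i ∧ g v = i} := fun i => by
    congr 1; ext v; simp [and_comm]
  simp only [hcomm] at h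
  refine le_trans ?_ h
  unfold disagreement
  push_cast
  refine sum_le_sum fun v _ => ?_
  norm_cast
  refine (card_le_card ?_).trans (card_union_le _ _)
  intro u
  simp only [mem_filter, mem_univ, true_and, mem_union]
  tauto

/-- The summand of `v` is the size of the symmetric difference of the two clusters containing `v`; a
bound that depends only on the `f`-cluster is counted once per vertex of that cluster. -/
theorem sum_le_disagreement (f : V → ℕ) (g : V → β) {N : ℕ} (hf : ∀ v, f v < N) (l : ℕ → ℤ)
    (h : ∀ v, l (f v) ≤ #{u | ¬ (f u = f v ↔ g u = g v)}) :
    ∑ i ∈ range N, (#{v | f v = i} : ℤ) * l i ≤ disagreement f g := by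
  unfold disagreement
  push_cast
  rw [← sum_fiberwise_of_maps_to (s := univ) (t := range N) (g := f)
    (fun v _ => mem_range.2 (hf v))]
  refine sum_le_sum fun i _ => ?_
  rw [← nsmul_eq_mul]
  refine card_nsmul_le_sum _ _ _ fun v hv => ?_
  have := (mem_filter.1 hv).2
  exact this ▸ h v

/-- The symmetric difference of two clusters is at least the differences of the numbers of vertices
of the two colours. -/
theorem abs_sub_add_abs_sub_le_card (f : V → α) (g : V → β) (col : V → Colour) (v : V) :
    |(#{u | col u = .blue ∧ f u = f v} : ℤ) - #{u | col u = .blue ∧ g u = g v}| +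
      |(#{u | col u = .red ∧ f u = f v} : ℤ) - #{u | col u = .red ∧ g u = g v}| ≤
    #{u | ¬ (f u = f v ↔ g u = g v)} := by
  classical
  have key : ∀ c, |(#{u | col u = c ∧ f u = f v} : ℤ) - #{u | col u = c ∧ g u = g v}| ≤
      #{u | col u = c ∧ ¬ (f u = f v ↔ g u = g v)} := by
    intro c
    have h1 : #{u | col u = c ∧ f u = f v} ≤ #{u | col u = c ∧ g u = g v} +
        #{u | col u = c ∧ ¬ (f u = f v ↔ g u = g v)} := by
      refine (card_le_card ?_).trans (card_union_le _ _)
      intro u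
      simp only [mem_filter, mem_univ, true_and, mem_union]
      tauto
    have h2 : #{u | col u = c ∧ g u = g v} ≤ #{u | col u = c ∧ f u = f v} +
        #{u | col u = c ∧ ¬ (f u = f v ↔ g u = g v)} := by
      refine (card_le_card ?_).trans (card_union_le _ _)
      intro u
      simp only [mem_filter, mem_univ, true_and, mem_union]
      tauto
    rw [abs_le]
    constructor <;> linarith [(Int.ofNat_le.2 h1), (Int.ofNat_le.2 h2)]
  have hsum : #{u | ¬ (f u = f v ↔ g u = g v)} =
      #{u | col u = .blue ∧ ¬ (f u = f v ↔ g u = g v)} +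
        #{u | col u = .red ∧ ¬ (f u = f v ↔ g u = g v)} := by
    rw [← card_union_of_disjoint]
    · congr 1
      ext u
      cases hc : col u <;> simp [hc]
    · rw [disjoint_left]
      intro u h h'
      simp only [mem_filter, mem_univ, true_and] at h h'
      rw [h.1] at h'
      simp at h'
  rw [hsum]
  push_cast
  exact add_le_add (key _) (key _)

end Disagreement

/-! ## Quality of rounding the clusters by quotas -/

section Rounding

open Finset

/-- Rounding the residues `s i` modulo `P` up on `U` and down elsewhere costs at most four times the
lower bound `∑ i, c i * l i`, if `U` prefers the large clusters of large residue. -/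
theorem sum_rounding_le {N : ℕ} {P : ℤ} {c s l : ℕ → ℤ} {U : Finset ℕ} (hU : U ⊆ range N)
    (hs0 : ∀ i, 0 ≤ s i) (hsP : ∀ i, s i < P) (hsc : ∀ i, s i ≤ c i)
    (hheavy : ∀ i, P < 2 * s i → P - s i ≤ l i)
    (hlight : ∀ i, 2 * s i ≤ P → (P ≤ c i ∧ s i ≤ l i) ∨ P - s i ≤ l i)
    (hUh : ∀ j ∈ U, P < 2 * s j ∨ c j = 0)
    (hgreedy : ∀ i ∈ range N, i ∉ U → P < 2 * s i → ∀ j ∈ U, c i ≤ c j)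
    (hsum : ∑ i ∈ range N, s i = P * #U) :
    ∑ i ∈ range N, (if i ∈ U then (c i + (P - s i)) ^ 2 - c i ^ 2 else c i ^ 2 - (c i - s i) ^ 2) ≤
      4 * ∑ i ∈ range N, c i * l i := by
  -- The left side is half of the priced cost of a light cluster at the price `-(2 * P)` used below.
  have hlight' : ∀ i, 2 * s i ≤ P → 2 * c i * s i + s i * (P - s i) ≤ 4 * (c i * l i) := by
    intro i hi
    have h0 := hs0 i; have h1 := hsP i; have h2 := hsc i
    rcases hlight i hi with ⟨h3, h4⟩ | h3
    · nlinarith [mul_le_mul_of_nonneg_left h4 (h0.trans h2), mul_le_mul_of_nonneg_left h3 h0,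
        mul_nonneg h0 h0, mul_nonneg h0 (h0.trans h2)]
    · nlinarith [mul_le_mul_of_nonneg_left h3 (h0.trans h2),
        mul_nonneg (h0.trans h2) (by linarith : 0 ≤ P - s i - s i),
        mul_nonneg (sub_nonneg.2 h2) (by linarith : 0 ≤ P - s i),
        mul_nonneg (h0.trans h2) (by linarith : 0 ≤ P - s i)]
  have hheavy' : ∀ i, P < 2 * s i → c i * (P - s i) ≤ c i * l i := fun i hi =>
    mul_le_mul_of_nonneg_left (hheavy i hi) ((hs0 i).trans (hsc i))
  -- A dual variable for the constraint `hsum`: the priced terms sum to zero, so an estimate cluster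
  -- by cluster is enough. Costs are doubled to keep the price an integer.
  obtain ⟨price, hprice⟩ : ∃ price : ℤ, ∀ i ∈ range N,
      2 * (if i ∈ U then (c i + (P - s i)) ^ 2 - c i ^ 2 else c i ^ 2 - (c i - s i) ^ 2) +
        price * ((if i ∈ U then P else 0) - s i) ≤ 8 * (c i * l i) := by
    rcases ((range N).filter fun i => i ∉ U ∧ P < 2 * s i).eq_empty_or_nonempty with hE | hE
    -- All clusters rounded down are light. At this price a new cluster, whose doubled cost is `2 *
    -- P ^ 2`, breaks even.
    · refine ⟨-(2 * P), fun i hi => ?_⟩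
      have h0 := hs0 i; have h1 := hsP i; have h2 := hsc i
      split_ifs with hiU
      · rcases hUh i hiU with h | h
        · have := hheavy' i h
          nlinarith [mul_nonneg (sub_nonneg.2 h1.le) h0,
            mul_nonneg (sub_nonneg.2 h2) (sub_nonneg.2 h1.le)]
        · have : s i = 0 := by linarith
          rw [h, this]
          nlinarith
      · have h3 : 2 * s i ≤ P := by
          by_contra hcon
          have : i ∈ (range N).filter fun i => i ∉ U ∧ P < 2 * s i :=
            mem_filter.2 ⟨hi, hiU, not_le.1 hcon⟩
          simp [hE] at this
        have := hlight' i h3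
        nlinarith
    · obtain ⟨i₀, hi₀, hmax⟩ := exists_max_image _ c hE
      obtain ⟨hi₀N, hi₀U, hi₀h⟩ := mem_filter.1 hi₀
      -- Here `i₀` is a largest heavy cluster rounded down. By the greedy choice all of `U` is at
      -- least as large, hence contains no empty cluster, and the other heavy clusters rounded down
      -- are no larger. The price balances these two groups at size `c i₀`.
      refine ⟨4 * c i₀ - P, fun i hi => ?_⟩
      have h0 := hs0 i; have h1 := hsP i; have h2 := hsc i
      have hc₀ : P < 2 * c i₀ := by linarith [hsc i₀]
      split_ifs with hiU
      · have h3 := hgreedy i₀ hi₀N hi₀U hi₀h i hiU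
        rcases hUh i hiU with h | h
        · have := hheavy' i h
          nlinarith [mul_nonneg (sub_nonneg.2 h3) (sub_nonneg.2 h1.le),
            mul_nonneg (sub_nonneg.2 h.le) (sub_nonneg.2 h1.le)]
        · linarith
      · by_cases h : P < 2 * s i
        · have h3 := hmax i (mem_filter.2 ⟨hi, hiU, h⟩)
          have := hheavy' i h
          nlinarith [mul_nonneg (sub_nonneg.2 h3) h0, mul_nonneg (sub_nonneg.2 h.le) h0,
            mul_nonneg (h0.trans h2) (sub_nonneg.2 h1.le)]
        · have := hlight' i (not_lt.1 h)
          nlinarith [mul_nonneg h0 (sub_nonneg.2 h1.le), mul_nonneg h0 (sub_nonneg.2 hc₀.le)]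
  have h := sum_le_sum hprice
  rw [sum_add_distrib, ← mul_sum, ← mul_sum, ← mul_sum, sum_sub_distrib, hsum, ← sum_filter,
    filter_mem_eq_inter, inter_eq_right.2 hU, sum_const, nsmul_eq_mul] at h
  linarith [mul_comm P (#U : ℤ)]

/-! ### Cost of the blue stage, of the red stage, and of both together. -/

variable {V β : Type*} [Fintype V] [DecidableEq β]

theorem card_filter_colour (col : V → Colour) (p : V → Prop) [DecidablePred p] :
    #{v | p v} = #{v | col v = .blue ∧ p v} + #{v | col v = .red ∧ p v} := by
  classical
  rw [← card_union_of_disjoint]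
  · congr 1
    ext u
    cases hc : col u <;> simp [hc]
  · rw [disjoint_left]
    intro u h h'
    simp only [mem_filter, mem_univ, true_and] at h h'
    rw [h.1] at h'
    simp at h'

/-- In every cluster of the labelling `g` there are red vertices, and `P` times as many blue ones. -/
def FairLabels (col : V → Colour) (P : ℕ) (g : V → β) : Prop :=
  ∀ v, #{u | col u = .blue ∧ g u = g v} = P * #{u | col u = .red ∧ g u = g v} ∧
    0 < #{u | col u = .red ∧ g u = g v}

/-- The labelling `h` has `Q i` vertices of colour `x` in the cluster `i`, as many of them as
possible from the cluster `i` of `f`. -/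
def Fills (col : V → Colour) (x : Colour) (f h : V → ℕ) (Q : ℕ → ℕ) : Prop :=
  ∀ i, #{v | col v = x ∧ h v = i} = Q i ∧
    #{v | col v = x ∧ f v = i ∧ h v = i} = min (Q i) #{v | col v = x ∧ f v = i}

/-- `U` consists of clusters of residue more than `P / 2` modulo `P` and of empty clusters, and
among the former the largest ones. -/
def Greedy (P N : ℕ) (c s : ℕ → ℕ) (U : Finset ℕ) : Prop :=
  U ⊆ range N ∧ (∀ j ∈ U, P < 2 * s j ∨ c j = 0) ∧
    ∀ i < N, i ∉ U → P < 2 * s i → ∀ j ∈ U, c i ≤ c j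

/-- No multiple of `P` is nearer than the one just below or the one just above. -/
theorem abs_mul_sub_ge {P a k s : ℤ} (hs0 : 0 ≤ s) (hsP : s < P) :
    min s (P - s) ≤ |P * a + s - P * k| := by
  rcases le_or_gt k a with h | h
  · refine (min_le_left _ _).trans (le_trans ?_ (le_abs_self _))
    nlinarith
  · refine (min_le_right _ _).trans (le_trans ?_ (neg_le_abs _))
    nlinarith

/-- The intermediate labelling moves only blue vertices. Rounding a cluster down removes exactly its
residue and rounding up only adds vertices, so the cost is the sum in `sum_rounding_le`, and `l`
below supplies the lower bound. -/
theorem disagreement_blue_le {col : V → Colour} {P N : ℕ} {f h : V → ℕ} {g : V → β} {U : Finset ℕ}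
    (hP : 2 ≤ P) (hf : ∀ v, f v < N) (hh : ∀ v, h v < N)
    (hbal : #{v | col v = .blue} = P * #{v | col v = .red})
    (hU : Greedy P N (fun i => #{v | f v = i}) (fun i => #{v | col v = .blue ∧ f v = i} % P) U)
    (hsum : ∑ i ∈ range N, (#{v | col v = .blue ∧ f v = i} / P + if i ∈ U then 1 else 0) =
      #{v | col v = .red})
    (hblue : Fills col .blue f h fun i =>
      P * (#{v | col v = .blue ∧ f v = i} / P + if i ∈ U then 1 else 0))
    (hg : FairLabels col P g) :
    disagreement f (fun v => if col v = .blue then h v else f v) ≤ 4 * disagreement f g := by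
  obtain ⟨hUN, hUh, hgreedy⟩ := hU
  set b : ℕ → ℕ := fun i => #{v | col v = .blue ∧ f v = i} with hb
  set r : ℕ → ℕ := fun i => #{v | col v = .red ∧ f v = i} with hr
  set c : ℕ → ℕ := fun i => #{v | f v = i} with hc
  have hP0 : 0 < P := by omega
  have hcbr : ∀ i, c i = b i + r i := fun i => card_filter_colour col _
  have hdm : ∀ i, (P : ℤ) * ((b i / P : ℕ) : ℤ) + ((b i % P : ℕ) : ℤ) = b i := fun i => by
    exact_mod_cast Nat.div_add_mod (b i) P
  have hmod : ∀ i, ((b i % P : ℕ) : ℤ) < P := fun i => by exact_mod_cast Nat.mod_lt _ hP0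
  have hsumb : ∑ i ∈ range N, b i = P * #{v | col v = .red} := by
    rw [← hbal, card_eq_sum_card_fiberwise (f := f) (t := range N)
      (fun v _ => mem_coe.2 (mem_range.2 (hf v)))]
    refine sum_congr rfl fun i _ => ?_
    rw [filter_filter]
  -- The distance from `b i` to the nearest positive multiple of `P`: rounding down to zero is not
  -- available to a nonempty fair cluster, hence the exception for `b i < P`.
  let l : ℕ → ℤ := fun i => if P < 2 * (b i % P) then (P : ℤ) - (b i % P : ℕ) else
    if P ≤ b i then ((b i % P : ℕ) : ℤ) else (P : ℤ) - (b i % P : ℕ)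
  have hlow : ∑ i ∈ range N, (c i : ℤ) * l i ≤ disagreement f g := by
    refine sum_le_disagreement f g hf l fun v => ?_
    refine le_trans ?_ (abs_sub_add_abs_sub_le_card f g col v)
    obtain ⟨h1, h2⟩ := hg v
    have h3 : l (f v) ≤ |(b (f v) : ℤ) - (P : ℤ) * #{u | col u = .red ∧ g u = g v}| := by
      have h4 := abs_mul_sub_ge (a := ((b (f v) / P : ℕ) : ℤ))
        (k := (#{u | col u = .red ∧ g u = g v} : ℤ)) (Int.natCast_nonneg (b (f v) % P)) (hmod (f v))
      rw [hdm] at h4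
      simp only [l]
      split_ifs with h5 h6
      · exact le_trans (le_min (by omega) le_rfl) h4
      · exact le_trans (le_min le_rfl (by omega)) h4
      · have h7 : b (f v) % P = b (f v) := Nat.mod_eq_of_lt (not_le.1 h6)
        rw [h7]
        refine le_trans ?_ (neg_le_abs _)
        have : (1 : ℤ) ≤ #{u | col u = .red ∧ g u = g v} := by exact_mod_cast h2
        nlinarith
    have h4 := abs_nonneg
      ((#{u | col u = .red ∧ f u = f v} : ℤ) - #{u | col u = .red ∧ g u = g v})
    have h5 : (#{u | col u = .blue ∧ g u = g v} : ℤ) =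
        (P : ℤ) * #{u | col u = .red ∧ g u = g v} := by exact_mod_cast h1
    rw [h5]
    linarith
  have hupp := disagreement_le_sum f (fun v => if col v = .blue then h v else f v) hf
    (fun v => by split_ifs; exacts [hh v, hf v])
  have hround := sum_rounding_le (P := (P : ℤ)) (c := fun i => (c i : ℤ))
    (s := fun i => ((b i % P : ℕ) : ℤ)) (l := l) hUN (fun i => Int.natCast_nonneg _) hmod
    (fun i => by
      have := Nat.mod_le (b i) P
      have := hcbr i
      omega)
    (fun i hi => by
      have : P < 2 * (b i % P) := by exact_mod_cast hi
      simp [l, this])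
    (fun i hi => by
      have h1 : ¬ P < 2 * (b i % P) := by rw [not_lt]; exact_mod_cast hi
      have := hcbr i
      by_cases h2 : P ≤ b i
      · left
        simp only [l, if_neg h1, if_pos h2, le_refl, and_true]
        omega
      · right
        simp [l, h2])
    (fun j hj => (hUh j hj).imp (fun h => by exact_mod_cast h) (fun h => by exact_mod_cast h))
    (fun i hi hiU hs j hj => by
      exact_mod_cast hgreedy i (mem_range.1 hi) hiU (by exact_mod_cast hs) j hj)
    -- Both `∑ b i` and the sum of the rounded values equal `P` times the number of red vertices, so
    -- the residues add up to `P` for each cluster rounded up.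
    (by
      rw [sum_add_distrib, ← sum_filter, filter_mem_eq_inter, inter_eq_right.2 hUN, sum_const,
        smul_eq_mul, mul_one] at hsum
      have h1 : ∑ i ∈ range N, b i = P * ∑ i ∈ range N, b i / P + ∑ i ∈ range N, b i % P := by
        rw [mul_sum, ← sum_add_distrib]
        exact sum_congr rfl fun i _ => (Nat.div_add_mod (b i) P).symm
      rw [hsumb, ← hsum, mul_add] at h1
      exact_mod_cast (Nat.add_left_cancel h1).symm)
  have hterm : ∀ i ∈ range N,
      (((#{v | f v = i} : ℤ) ^ 2 -
          (#{v | f v = i ∧ (if col v = .blue then h v else f v) = i} : ℤ) ^ 2) +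
        ((#{v | (if col v = .blue then h v else f v) = i} : ℤ) ^ 2 -
          (#{v | f v = i ∧ (if col v = .blue then h v else f v) = i} : ℤ) ^ 2)) =
      (if i ∈ U then ((c i : ℤ) + (P - (b i % P : ℕ))) ^ 2 - (c i : ℤ) ^ 2 else
        (c i : ℤ) ^ 2 - ((c i : ℤ) - (b i % P : ℕ)) ^ 2) := by
    intro i _
    have h1 : #{v | (if col v = .blue then h v else f v) = i} =
        P * (b i / P + if i ∈ U then 1 else 0) + r i := by
      rw [card_filter_colour col]
      refine congrArg₂ (· + ·) (Eq.trans ?_ (hblue i).1) ?_ <;>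
      · congr 1; ext v; cases hcv : col v <;> simp [hcv]
    have h2 : #{v | f v = i ∧ (if col v = .blue then h v else f v) = i} =
        min (P * (b i / P + if i ∈ U then 1 else 0)) (b i) + r i := by
      rw [card_filter_colour col]
      refine congrArg₂ (· + ·) (Eq.trans ?_ (hblue i).2) ?_ <;>
      · congr 1; ext v; cases hcv : col v <;> simp [hcv]
    have h3 := hdm i
    have h4 := hmod i
    have h5 : (c i : ℤ) = b i + r i := by exact_mod_cast hcbr i
    have h6 : (#{v | f v = i} : ℤ) = c i := rfl
    rw [h6, h1, h2]
    push_cast at h3 h4 ⊢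
    split_ifs with hiU
    · rw [min_eq_right (by linarith)]
      have h7 : (P : ℤ) * ((b i : ℤ) / P + 1) = b i + (P - (b i : ℤ) % P) := by linarith
      rw [h7, h5]; ring
    · have h8 : 0 ≤ (b i : ℤ) % P := Int.emod_nonneg _ (by omega)
      rw [add_zero, min_eq_left (by linarith)]
      have h7 : (P : ℤ) * ((b i : ℤ) / P) = b i - (b i : ℤ) % P := by linarith
      rw [h7, h5]; ring
  rw [sum_congr rfl hterm] at hupp
  have := hupp.trans (hround.trans (by linarith : _ ≤ 4 * (disagreement f g : ℤ)))
  exact_mod_cast this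

/-- A fair cluster with `x` red vertices differs from cluster `i` by at least `|P * k i - P * x| +
|r i - x|`, hence by at least `|r i - k i|`: correcting the red count is unavoidable, up to the
constant. -/
theorem disagreement_red_le {col : V → Colour} {P N : ℕ} {m h : V → ℕ} {g : V → β} {k : ℕ → ℕ}
    (hP : 2 ≤ P) (hm : ∀ v, m v < N) (hh : ∀ v, h v < N)
    (hblue : ∀ i, #{v | col v = .blue ∧ m v = i} = P * k i)
    (hmh : ∀ v, col v = .blue → m v = h v) (hred : Fills col .red m h k)
    (hg : FairLabels col P g) :
    2 * disagreement m h ≤ 5 * disagreement m g := by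
  set r : ℕ → ℕ := fun i => #{v | col v = .red ∧ m v = i} with hr
  have hlow : ∑ i ∈ range N, (#{v | m v = i} : ℤ) * |(r i : ℤ) - k i| ≤ disagreement m g := by
    refine sum_le_disagreement m g hm _ fun v => ?_
    refine le_trans ?_ (abs_sub_add_abs_sub_le_card m g col v)
    obtain ⟨h1, h2⟩ := hg v
    rw [hblue, h1]
    push_cast
    set x : ℤ := ((#{u | col u = .red ∧ g u = g v} : ℕ) : ℤ)
    have h3 : |(k (m v) : ℤ) - x| ≤ |(P : ℤ) * k (m v) - P * x| := by
      rw [← mul_sub, abs_mul]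
      have : (1 : ℤ) ≤ |(P : ℤ)| := by rw [Nat.abs_cast]; omega
      nlinarith [abs_nonneg ((k (m v) : ℤ) - x)]
    have h4 := abs_sub_le (r (m v) : ℤ) x (k (m v))
    rw [abs_sub_comm x] at h4
    linarith
  have hupp := disagreement_le_sum m h hm hh
  have hterm : ∀ i ∈ range N,
      2 * (((#{v | m v = i} : ℤ) ^ 2 - (#{v | m v = i ∧ h v = i} : ℤ) ^ 2) +
        ((#{v | h v = i} : ℤ) ^ 2 - (#{v | m v = i ∧ h v = i} : ℤ) ^ 2)) ≤
      5 * ((#{v | m v = i} : ℤ) * |(r i : ℤ) - k i|) := by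
    intro i _
    have h1 : #{v | m v = i} = P * k i + r i := by rw [card_filter_colour col, hblue]
    have h2 : #{v | h v = i} = P * k i + k i := by
      rw [card_filter_colour col, (hred i).1, ← hblue]
      congr 2
      ext v
      simp +contextual [hmh]
    have h3 : #{v | m v = i ∧ h v = i} = P * k i + min (k i) (r i) := by
      rw [card_filter_colour col, (hred i).2, ← hblue]
      congr 2
      ext v
      simp +contextual [hmh]
    rw [h1, h2, h3]
    push_cast
    have hP' : (2 : ℤ) ≤ P := by exact_mod_cast hP
    have hPk : 2 * (k i : ℤ) ≤ P * k i := by nlinarith [Int.natCast_nonneg (k i)]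
    have hr0 := Int.natCast_nonneg (r i)
    have hk0 := Int.natCast_nonneg (k i)
    set q : ℤ := P * k i
    -- For a surplus of red vertices the factor 2 would do. For a deficit the cluster grows to `q +
    -- k i`, and `2 * k i ≤ q`, which needs `2 ≤ P`, gives `5 / 2`.
    rcases le_total (k i : ℤ) (r i) with h | h
    · rw [min_eq_left h, abs_of_nonneg (sub_nonneg.2 h)]
      nlinarith [mul_nonneg (sub_nonneg.2 h) (by linarith : 0 ≤ q + r i),
        mul_nonneg (sub_nonneg.2 h) (sub_nonneg.2 h)]
    · rw [min_eq_right h, abs_of_nonpos (sub_nonpos.2 h)]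
      nlinarith [mul_nonneg (sub_nonneg.2 h) hr0, mul_nonneg (sub_nonneg.2 h) (sub_nonneg.2 hPk)]
  have hs := sum_le_sum hterm
  rw [← mul_sum, ← mul_sum] at hs
  have : (2 : ℤ) * disagreement m h ≤ 5 * disagreement m g := by linarith
  exact_mod_cast this

/-- Two triangle inequalities through the intermediate labelling `m`: `4 + 5 / 2 * (4 + 1) = 16.5`.
-/
theorem disagreement_fill_le {col : V → Colour} {P N : ℕ} {f h : V → ℕ} {g : V → β} {U : Finset ℕ}
    (hP : 2 ≤ P) (hf : ∀ v, f v < N) (hh : ∀ v, h v < N)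
    (hbal : #{v | col v = .blue} = P * #{v | col v = .red})
    (hU : Greedy P N (fun i => #{v | f v = i}) (fun i => #{v | col v = .blue ∧ f v = i} % P) U)
    (hsum : ∑ i ∈ range N, (#{v | col v = .blue ∧ f v = i} / P + if i ∈ U then 1 else 0) =
      #{v | col v = .red})
    (hblue : Fills col .blue f h fun i =>
      P * (#{v | col v = .blue ∧ f v = i} / P + if i ∈ U then 1 else 0))
    (hred : Fills col .red f h fun i =>
      #{v | col v = .blue ∧ f v = i} / P + if i ∈ U then 1 else 0)
    (hg : FairLabels col P g) :
    disagreement f h ≤ 17 * disagreement f g := by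
  set m : V → ℕ := fun v => if col v = .blue then h v else f v with hm
  have h1 : disagreement f m ≤ 4 * disagreement f g :=
    disagreement_blue_le hP hf hh hbal hU hsum hblue hg
  have h2 : 2 * disagreement m h ≤ 5 * disagreement m g := by
    refine disagreement_red_le (k := fun i =>
      #{v | col v = .blue ∧ f v = i} / P + if i ∈ U then 1 else 0) hP (N := N)
      (fun v => by simp only [hm]; split_ifs; exacts [hh v, hf v]) hh (fun i => ?_)
      (fun v hv => by simp [hm, hv]) (fun i => ?_) hg
    · refine Eq.trans ?_ (hblue i).1
      congr 1; ext v; simp +contextual [hm]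
    · refine ⟨(hred i).1, ?_⟩
      convert (hred i).2 using 2
      · ext v; simp +contextual [hm]
      · congr 1; ext v; simp +contextual [hm]
  have h3 := disagreement_triangle f m h
  have h4 := disagreement_triangle m f g
  rw [disagreement_comm m f] at h4
  omega

end Rounding

/-! ## Total correctness of programs -/

namespace RAM

@[simp] theorem Store.setVar_var (s : Store) (x k : ℕ) :
    (s.setVar x k).var = Function.update s.var x k := rfl

@[simp] theorem Store.setVar_arr (s : Store) (x k : ℕ) : (s.setVar x k).arr = s.arr := rfl

@[simp] theorem Store.setArr_var (s : Store) (a i k : ℕ) : (s.setArr a i k).var = s.var := rfl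

@[simp] theorem Store.setArr_arr (s : Store) (a i k : ℕ) :
    (s.setArr a i k).arr = Function.update s.arr a (Function.update (s.arr a) i k) := rfl

theorem Test.eval_eq_iff {s : Store} {e f : Expr} :
    (Test.eq e f).eval s = true ↔ e.eval s = f.eval s := decide_eq_true_iff

theorem Test.eval_lt_iff {s : Store} {e f : Expr} :
    (Test.lt e f).eval s = true ↔ e.eval s < f.eval s := decide_eq_true_iff

theorem Test.eval_lt_eq_false_iff {s : Store} {e f : Expr} :
    (Test.lt e f).eval s = false ↔ f.eval s ≤ e.eval s := decide_eq_false_iff_not.trans not_lt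

theorem Test.eval_and_iff {s : Store} {b c : Test} :
    (Test.and b c).eval s = true ↔ b.eval s = true ∧ c.eval s = true := Bool.and_eq_true_iff

/-- The program has no assignment to register `x`. -/
def Program.KeepsVar (x : ℕ) : Program → Prop
  | .skip => True
  | .assign y _ => x ≠ y
  | .put _ _ _ => True
  | .seq P Q => P.KeepsVar x ∧ Q.KeepsVar x
  | .branch _ P Q => P.KeepsVar x ∧ Q.KeepsVar x
  | .loop _ P => P.KeepsVar x

/-- The program has no assignment to array `a`. -/
def Program.KeepsArr (a : ℕ) : Program → Prop
  | .skip => True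
  | .assign _ _ => True
  | .put b _ _ => a ≠ b
  | .seq P Q => P.KeepsArr a ∧ Q.KeepsArr a
  | .branch _ P Q => P.KeepsArr a ∧ Q.KeepsArr a
  | .loop _ P => P.KeepsArr a

/-- The stores `s` and `s'` agree on everything that `P` does not assign to. -/
def Program.Frame (P : Program) (s s' : Store) : Prop :=
  (∀ x, P.KeepsVar x → s'.var x = s.var x) ∧ ∀ a, P.KeepsArr a → s'.arr a = s.arr a

theorem Program.Frame.refl (P : Program) (s : Store) : P.Frame s s :=
  ⟨fun _ _ => rfl, fun _ _ => rfl⟩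

theorem Program.Frame.trans {P : Program} {s s' s'' : Store} (h : P.Frame s s')
    (h' : P.Frame s' s'') : P.Frame s s'' :=
  ⟨fun x hx => (h'.1 x hx).trans (h.1 x hx), fun a ha => (h'.2 a ha).trans (h.2 a ha)⟩

theorem Program.Frame.mono {P Q : Program} {s s' : Store} (h : P.Frame s s')
    (hv : ∀ x, Q.KeepsVar x → P.KeepsVar x) (ha : ∀ a, Q.KeepsArr a → P.KeepsArr a) :
    Q.Frame s s' :=
  ⟨fun x hx => h.1 x (hv x hx), fun a hx => h.2 a (ha a hx)⟩

/-- Since `KeepsVar` and `KeepsArr` are syntactic, `simp` can decide them; invariants therefore need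
to mention only what a program changes. -/
theorem Exec.frame {P : Program} {s s' : Store} {t : ℕ} (h : Exec P s t s') : P.Frame s s' := by
  induction h with
  | skip s => exact .refl _ _
  | assign x e s =>
    exact ⟨fun y hy => Function.update_of_ne hy _ _, fun _ _ => rfl⟩
  | put a i e s =>
    exact ⟨fun _ _ => rfl, fun b hb => Function.update_of_ne hb _ _⟩
  | seq _ _ ih ih' =>
    exact (ih.mono (Q := .seq _ _) (fun _ h => h.1) fun _ h => h.1).trans
      (ih'.mono (fun _ h => h.2) fun _ h => h.2)
  | branchTrue _ _ ih => exact ih.mono (fun _ h => h.1) fun _ h => h.1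
  | branchFalse _ _ ih => exact ih.mono (fun _ h => h.2) fun _ h => h.2
  | loopDone _ => exact .refl _ _
  | loopStep _ _ _ ih ih' => exact (ih.mono (fun _ h => h) fun _ h => h).trans ih'

/-- Started in `s`, the program `P` halts after at most `T` steps in a store that satisfies `Q`. -/
def Runs (P : Program) (s : Store) (T : ℕ) (Q : Store → Prop) : Prop :=
  ∃ t s', Exec P s t s' ∧ t ≤ T ∧ Q s'

namespace Runs

variable {P P' : Program} {s : Store} {T T' : ℕ} {Q Q' : Store → Prop}

theorem mono (h : Runs P s T Q) (hT : T ≤ T') (hQ : ∀ s', Q s' → Q' s') : Runs P s T' Q' := by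
  obtain ⟨t, s', h1, h2, h3⟩ := h
  exact ⟨t, s', h1, h2.trans hT, hQ s' h3⟩

theorem frame (h : Runs P s T Q) : Runs P s T fun s' => Q s' ∧ P.Frame s s' := by
  obtain ⟨t, s', h1, h2, h3⟩ := h
  exact ⟨t, s', h1, h2, h3, h1.frame⟩

theorem assign {x : ℕ} {e : Expr} (h : Q (s.setVar x (e.eval s))) :
    Runs (.assign x e) s (e.cost + 1) Q :=
  ⟨_, _, .assign x e s, le_rfl, h⟩

theorem seq (h : Runs P s T Q) (h' : ∀ s', Q s' → Runs P' s' T' Q') :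
    Runs (.seq P P') s (T + T') Q' := by
  obtain ⟨t, s', h1, h2, h3⟩ := h
  obtain ⟨t', s'', h1', h2', h3'⟩ := h' s' h3
  exact ⟨_, _, h1.seq h1', add_le_add h2 h2', h3'⟩

theorem assign_seq {x : ℕ} {e : Expr} (h : Runs P' (s.setVar x (e.eval s)) T Q) :
    Runs (.seq (.assign x e) P') s (e.cost + 1 + T) Q :=
  seq (Q := fun s' => s' = s.setVar x (e.eval s)) (assign rfl) fun _ h' => h' ▸ h

/-- Loops with an invariant and a bound on the number of iterations. -/
theorem loop {b : Test} (Inv : Store → Prop) (μ : Store → ℕ) {m : ℕ} (h0 : Inv s) (hm : μ s ≤ m)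
    (hstep : ∀ s₁, P.Frame s s₁ → Inv s₁ → b.eval s₁ = true →
      Runs P s₁ T fun s' => Inv s' ∧ μ s' < μ s₁) :
    Runs (.loop b P) s (m * (b.cost + 1 + T) + (b.cost + 1)) fun s' =>
      (Inv s' ∧ b.eval s' = false) ∧ P.Frame s s' := by
  suffices h : ∀ m s₁, P.Frame s s₁ → Inv s₁ → μ s₁ ≤ m →
      Runs (.loop b P) s₁ (m * (b.cost + 1 + T) + (b.cost + 1)) fun s' => Inv s' ∧ b.eval s' = false
    from (h m s (.refl _ _) h0 hm).frame.mono le_rfl fun _ h => h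
  intro m
  induction m with
  | zero =>
    intro s₁ hf hi hμ
    cases hb : b.eval s₁ with
    | false => exact ⟨_, _, .loopDone hb, by omega, hi, hb⟩
    | true =>
      obtain ⟨_, s', _, _, _, h⟩ := hstep s₁ hf hi hb
      omega
  | succ m ih =>
    intro s₁ hf hi hμ
    cases hb : b.eval s₁ with
    | false => exact ⟨_, _, .loopDone hb, by omega, hi, hb⟩
    | true =>
      obtain ⟨t, s', h1, h2, h3, h4⟩ := hstep s₁ hf hi hb
      obtain ⟨t', s'', h1', h2', h3'⟩ := ih s' (hf.trans h1.frame) h3 (by omega)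
      refine ⟨_, _, .loopStep hb h1 h1', ?_, h3'⟩
      rw [Nat.succ_mul]
      omega

end Runs

/-- Increase register `x` by one. -/
def Program.inc (x : ℕ) : Program := .assign x (.add (.var x) (.lit 1))

/-- Run `P` for the values `0, …, n - 1` of register `i`, where `n` is the content of register
`0`. -/
def Program.for (i : ℕ) (P : Program) : Program :=
  .seq (.assign i (.lit 0)) (.loop (.lt (.var i) (.var 0)) (.seq P (.inc i)))

/-- Each round adds 4 steps for the test and 4 for the increment; the initial assignment and the
final test cost 6. -/
theorem Runs.for {i : ℕ} {P : Program} {s : Store} {n T : ℕ} (Inv : ℕ → Store → Prop)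
    (hn : s.var 0 = n) (hi : i ≠ 0) (hPi : P.KeepsVar i) (hP0 : P.KeepsVar 0)
    (h0 : Inv 0 (s.setVar i 0))
    (hstep : ∀ v < n, ∀ s₁, s₁.var i = v → (Program.for i P).Frame s s₁ → Inv v s₁ →
      Runs P s₁ T fun s' => Inv (v + 1) (s'.setVar i (v + 1))) :
    Runs (.for i P) s (n * (T + 8) + 6) fun s' => Inv n s' ∧ (Program.for i P).Frame s s' := by
  have hkv : (Program.for i P).KeepsVar 0 := ⟨hi.symm, hP0, hi.symm⟩
  have h := Runs.seq (s := s) (P := .assign i (.lit 0))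
    (Q := fun s' => s' = s.setVar i 0) (Runs.assign rfl)
    (P' := .loop (.lt (.var i) (.var 0)) (.seq P (.inc i))) (T' := n * (4 + (T + 4)) + 4)
    (Q' := fun s' => Inv n s') (by
      rintro s' rfl
      refine (Runs.loop (P := .seq P (.inc i)) (T := T + 4)
        (fun s₁ => Inv (s₁.var i) s₁ ∧ s₁.var i ≤ n) (fun s₁ => n - s₁.var i)
        (m := n) ?_ (Nat.sub_le _ _) ?_).mono le_rfl ?_
      · simpa using h0
      · rintro s₁ hf ⟨hinv, hle⟩ hb
        have hf0 : s₁.var 0 = n := by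
          rw [hf.1 0 ⟨hP0, hi.symm⟩, Store.setVar_var, Function.update_of_ne hi.symm, hn]
        have hlt : s₁.var i < n := by simpa [Test.eval_lt_iff, Expr.eval, hf0] using hb
        have hF : (Program.for i P).Frame s s₁ := by
          refine Program.Frame.trans (s' := s.setVar i 0) ?_
            (hf.mono (fun x hx => hx.2) fun x hx => hx.2)
          exact ⟨fun x hx => Function.update_of_ne hx.1 _ _, fun _ _ => rfl⟩
        refine Runs.seq (hstep _ hlt s₁ rfl hF hinv).frame fun s₂ hs₂ => ?_
        have h2 : s₂.var i = s₁.var i := hs₂.2.1 i hPi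
        refine Runs.assign ?_
        simp only [Expr.eval, h2, Store.setVar_var, Function.update_self]
        exact ⟨⟨hs₂.1, hlt⟩, by omega⟩
      · rintro s' ⟨⟨⟨hinv, hle⟩, hb⟩, hf⟩
        have hf0 : s'.var 0 = n := by
          rw [hf.1 0 ⟨hP0, hi.symm⟩, Store.setVar_var, Function.update_of_ne hi.symm, hn]
        have : n ≤ s'.var i := by simpa [Test.eval_lt_eq_false_iff, Expr.eval, hf0] using hb
        rwa [le_antisymm hle this] at hinv)
  refine h.frame.mono (le_of_eq ?_) fun _ h => h
  simp only [Expr.cost]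
  ring

/-- Programs without loops. -/
def Program.Straight : Program → Prop
  | .seq P Q => P.Straight ∧ Q.Straight
  | .branch _ P Q => P.Straight ∧ Q.Straight
  | .loop _ _ => False
  | _ => True

/-- The effect of a program without loops. -/
def Program.run : Program → Store → Store
  | .skip, s => s
  | .assign x e, s => s.setVar x (e.eval s)
  | .put a i e, s => s.setArr a (i.eval s) (e.eval s)
  | .seq P Q, s => Q.run (P.run s)
  | .branch b P Q, s => if b.eval s = true then P.run s else Q.run s
  | .loop _ _, s => s

/-- A bound on the running time of a program without loops. -/
def Program.cost : Program → ℕ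
  | .skip => 1
  | .assign _ e => e.cost + 1
  | .put _ i e => i.cost + e.cost + 1
  | .seq P Q => P.cost + Q.cost
  | .branch b P Q => b.cost + 1 + (P.cost + Q.cost)
  | .loop _ _ => 0

/-- Reduces a loop body to the function `run`, which `simp` can evaluate. The cost adds both arms of
a branch, a crude bound that suffices. -/
theorem Runs.straight {P : Program} {s : Store} {Q : Store → Prop} (hP : P.Straight)
    (h : Q (P.run s)) : Runs P s P.cost Q := by
  suffices h' : ∀ s, ∃ t ≤ P.cost, Exec P s t (P.run s) by
    obtain ⟨t, h1, h2⟩ := h' s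
    exact ⟨t, _, h2, h1, h⟩
  clear h
  induction P with
  | skip => exact fun s => ⟨_, le_rfl, .skip s⟩
  | assign x e => exact fun s => ⟨_, le_rfl, .assign x e s⟩
  | put a i e => exact fun s => ⟨_, le_rfl, .put a i e s⟩
  | seq P Q ihP ihQ =>
    intro s
    obtain ⟨t, h1, h2⟩ := ihP hP.1 s
    obtain ⟨t', h1', h2'⟩ := ihQ hP.2 (P.run s)
    exact ⟨_, add_le_add h1 h1', h2.seq h2'⟩
  | branch b P Q ihP ihQ =>
    intro s
    by_cases hb : b.eval s = true
    · obtain ⟨t, h1, h2⟩ := ihP hP.1 s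
      refine ⟨_, ?_, .branchTrue hb (by simpa [Program.run, hb] using h2)⟩
      simp only [Program.cost]; omega
    · obtain ⟨t, h1, h2⟩ := ihQ hP.2 s
      refine ⟨_, ?_, .branchFalse (by simpa using hb) (by simpa [Program.run, hb] using h2)⟩
      simp only [Program.cost]; omega
  | loop b P => exact hP.elim

end RAM

/-! ## The algorithm -/

section Counting

open Finset

theorem count_congr_of_lt {p q : ℕ → Prop} [DecidablePred p] [DecidablePred q] {n : ℕ}
    (h : ∀ u < n, (p u ↔ q u)) : Nat.count p n = Nat.count q n := by
  rw [Nat.count_eq_card_filter_range, Nat.count_eq_card_filter_range]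
  congr 1
  exact filter_congr fun u hu => h u (mem_range.1 hu)

theorem count_le_of_imp {p q : ℕ → Prop} [DecidablePred p] [DecidablePred q] {n : ℕ}
    (h : ∀ u < n, p u → q u) : Nat.count p n ≤ Nat.count q n := by
  rw [Nat.count_eq_card_filter_range, Nat.count_eq_card_filter_range]
  refine card_le_card fun u hu => ?_
  rw [mem_filter] at hu ⊢
  exact ⟨hu.1, h u (mem_range.1 hu.1) hu.2⟩

/-- The old contribution of `v` stands on one side and the new one on the other, so that no
truncated subtraction occurs. -/
theorem count_update (R : ℕ → ℕ → Prop) [∀ u x, Decidable (R u x)] (L : ℕ → ℕ) (x : ℕ) {v n : ℕ}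
    (hv : v < n) :
    Nat.count (fun u => R u (Function.update L v x u)) n + (if R v (L v) then 1 else 0) =
      Nat.count (fun u => R u (L u)) n + (if R v x then 1 else 0) := by
  induction n with
  | zero => omega
  | succ n ih =>
    rw [Nat.count_succ, Nat.count_succ]
    rcases Nat.lt_succ_iff_lt_or_eq.1 hv with h | rfl
    · rw [Function.update_of_ne h.ne']
      have := ih h
      omega
    · rw [Function.update_self, count_congr_of_lt (q := fun u => R u (L u))
        fun u hu => by rw [Function.update_of_ne hu.ne]]
      omega

theorem count_update_of_not {R : ℕ → ℕ → Prop} [∀ u x, Decidable (R u x)] {L : ℕ → ℕ} {x v n : ℕ}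
    (hv : v < n) (h0 : ¬ R v (L v)) (h1 : R v x) :
    Nat.count (fun u => R u (Function.update L v x u)) n = Nat.count (fun u => R u (L u)) n + 1 := by
  have h := count_update R L x hv
  rwa [if_neg h0, if_pos h1] at h

theorem count_update_of_not_of_not {R : ℕ → ℕ → Prop} [∀ u x, Decidable (R u x)] {L : ℕ → ℕ}
    {x v n : ℕ} (hv : v < n) (h0 : ¬ R v (L v)) (h1 : ¬ R v x) :
    Nat.count (fun u => R u (Function.update L v x u)) n = Nat.count (fun u => R u (L u)) n := by
  have h := count_update R L x hv
  rwa [if_neg h0, if_neg h1] at h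

theorem sum_range_update (q : ℕ → ℕ) (x : ℕ) {i N : ℕ} (hi : i < N) :
    ∑ l ∈ range N, Function.update q i x l + q i = ∑ l ∈ range N, q l + x := by
  rw [sum_update_of_mem (mem_range.2 hi), sum_eq_add_sum_sdiff_singleton_of_mem (mem_range.2 hi) q]
  omega

end Counting

/-! ### Colour ratio, cluster statistics and the number of clusters to round up. -/

namespace RAM

/-- Count the blue vertices in register `2`. -/
def countBlue : Program :=
  .for 1 (.branch (.eq (.get 0 (.var 1)) (.lit 1)) (.inc 2) .skip)

theorem countBlue_runs {s : Store} {n : ℕ} (hn : s.var 0 = n) (h2 : s.var 2 = 0) :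
    Runs countBlue s (n * 18 + 6) fun s' =>
      s'.var 2 = Nat.count (fun u => s.arr 0 u = 1) n ∧ countBlue.Frame s s' := by
  refine (Runs.for (T := 10) (fun v s' => s'.var 2 = Nat.count (fun u => s.arr 0 u = 1) v) hn
    (by simp) (by simp [Program.inc, Program.KeepsVar]) (by simp [Program.inc, Program.KeepsVar])
    (by simpa using h2) ?_).mono le_rfl fun _ h => h
  intro v hv s₁ h1 hf hinv
  have ha : s₁.arr 0 = s.arr 0 := hf.2 0 (by simp [Program.KeepsArr, Program.for, Program.inc])
  refine (Runs.straight (by simp [Program.Straight, Program.inc]) ?_).mono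
    (by simp [Program.cost, Program.inc, Expr.cost, Test.cost]) fun _ h => h
  simp only [Program.run, Test.eval_eq_iff, Expr.eval, Program.inc, h1, ha, Nat.count_succ]
  split_ifs with h <;> simp_all

/-- Put the number of red vertices into register `3`, and the ratio of the colours into register
`4`. -/
def computeRatio : Program :=
  .seq (.assign 3 (.sub (.var 0) (.var 2))) (.seq (.assign 4 (.lit 2))
    (.seq (.assign 5 (.add (.var 3) (.var 3)))
      (.loop (.lt (.var 5) (.var 2)) (.seq (.inc 4) (.assign 5 (.add (.var 5) (.var 3)))))))

/-- The loop finds the least `k ≥ 2` for which `k` times the number of red vertices reaches the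
number of blue ones. This is `p` if there is a red vertex; otherwise there are no blue ones either
and 2 is returned, so only a valid ratio is promised. -/
theorem computeRatio_runs {s : Store} {n p : ℕ} (hp : 2 ≤ p)
    (hb : s.var 2 = p * (s.var 0 - s.var 2)) (hn : s.var 2 ≤ n) :
    Runs computeRatio s (n * 12 + 14) fun s' =>
      (s'.var 3 = s.var 0 - s.var 2 ∧ 2 ≤ s'.var 4 ∧ s.var 2 = s'.var 4 * s'.var 3) ∧
        computeRatio.Frame s s' := by
  refine (Runs.frame (Runs.assign_seq (Runs.assign_seq (Runs.assign_seq (T := n * 12 + 4) ?_)))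
    ).mono (by simp only [Expr.cost]; omega) fun _ h => h
  generalize h₃ : Store.setVar _ 5 _ = s₃
  set R := s.var 0 - s.var 2 with hR
  have hv2 : s₃.var 2 = s.var 2 := by simp [← h₃]
  have hv3 : s₃.var 3 = R := by simp [← h₃, Expr.eval, hR]
  refine (Runs.loop (T := 8) (fun s' => 2 ≤ s'.var 4 ∧ s'.var 4 ≤ p ∧ s'.var 5 = s'.var 4 * R)
    (fun s' => s.var 2 - s'.var 5) ?_ ((Nat.sub_le _ _).trans hn) ?_).mono
    (by simp [Expr.cost, Test.cost]) ?_
  · simp [← h₃, Expr.eval, hR, hp, two_mul]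
  · rintro s₄ hf ⟨h4, h4p, h5⟩ hlt
    have e2 : s₄.var 2 = s.var 2 := (hf.1 2 (by simp [Program.KeepsVar, Program.inc])).trans hv2
    have e3 : s₄.var 3 = R := (hf.1 3 (by simp [Program.KeepsVar, Program.inc])).trans hv3
    have hlt' : s₄.var 5 < s.var 2 := by simpa [Test.eval_lt_iff, Expr.eval, e2] using hlt
    rw [h5, hb] at hlt'
    have hlt4 : s₄.var 4 < p := lt_of_mul_lt_mul_right hlt' (Nat.zero_le _)
    have hR0 : 0 < R := by
      rcases Nat.eq_zero_or_pos R with h | h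
      · simp [h] at hlt'
      · exact h
    refine (Runs.straight (by simp [Program.Straight, Program.inc]) ?_).mono
      (by simp [Program.cost, Program.inc, Expr.cost]) fun _ h => h
    simp only [Program.run, Program.inc, Expr.eval, Store.setVar_var]
    simp only [e3, h5, Function.update_self, ne_eq, Nat.reduceEqDiff,
      not_false_eq_true, Function.update_of_ne, add_mul, one_mul, hb, and_true]
    refine ⟨⟨by omega, hlt4⟩, by omega⟩
  · rintro s' ⟨⟨⟨h4, h4p, h5⟩, hge⟩, hf⟩
    have e2 : s'.var 2 = s.var 2 := (hf.1 2 (by simp [Program.KeepsVar, Program.inc])).trans hv2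
    have e3 : s'.var 3 = R := (hf.1 3 (by simp [Program.KeepsVar, Program.inc])).trans hv3
    have hge' : s.var 2 ≤ s'.var 5 := by simpa [Test.eval_lt_eq_false_iff, Expr.eval, e2] using hge
    refine ⟨e3, h4, ?_⟩
    rw [e3, ← h5]
    refine le_antisymm hge' ?_
    rw [h5, hb]
    exact Nat.mul_le_mul_right _ h4p

/-- Count the vertices of each cluster in array `3`, and the blue ones in multiples of register `4`
in array `5` and array `6`, with the remainder in array `4`. -/
def countClusters : Program :=
  .for 1 (.seq (.put 3 (.get 1 (.var 1)) (.add (.get 3 (.get 1 (.var 1))) (.lit 1)))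
    (.branch (.eq (.get 0 (.var 1)) (.lit 1))
      (.seq (.put 4 (.get 1 (.var 1)) (.add (.get 4 (.get 1 (.var 1))) (.lit 1)))
        (.branch (.eq (.get 4 (.get 1 (.var 1))) (.var 4))
          (.seq (.put 4 (.get 1 (.var 1)) (.lit 0))
            (.seq (.put 5 (.get 1 (.var 1)) (.add (.get 5 (.get 1 (.var 1))) (.lit 1)))
              (.put 6 (.get 1 (.var 1)) (.add (.get 6 (.get 1 (.var 1))) (.var 4)))))
          .skip))
      .skip))

/-- Division with remainder by counting: the residue is reset on reaching `P` and carried into the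
quotient. Array 6 accumulates `P` times the quotient because the machine cannot multiply. -/
theorem countClusters_runs {s : Store} {n P : ℕ} (hn : s.var 0 = n) (h4 : s.var 4 = P)
    (hP : 0 < P) (a3 : s.arr 3 = 0) (a4 : s.arr 4 = 0) (a5 : s.arr 5 = 0) (a6 : s.arr 6 = 0) :
    Runs countClusters s (n * 60 + 6) fun s' =>
      (∀ l, s'.arr 3 l = Nat.count (fun u => s.arr 1 u = l) n ∧
        Nat.count (fun u => s.arr 0 u = 1 ∧ s.arr 1 u = l) n = P * s'.arr 5 l + s'.arr 4 l ∧
        s'.arr 4 l < P ∧ s'.arr 6 l = P * s'.arr 5 l) ∧ countClusters.Frame s s' := by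
  refine (Runs.for (T := 52) (fun v s' =>
    ∀ l, s'.arr 3 l = Nat.count (fun u => s.arr 1 u = l) v ∧
        Nat.count (fun u => s.arr 0 u = 1 ∧ s.arr 1 u = l) v = P * s'.arr 5 l + s'.arr 4 l ∧
        s'.arr 4 l < P ∧ s'.arr 6 l = P * s'.arr 5 l) hn
    (by simp) (by simp [Program.KeepsVar]) (by simp [Program.KeepsVar])
    (by simp [a3, a4, a5, a6, hP]) ?_).mono le_rfl fun _ h => h
  intro v hv s₁ h1 hf hinv
  have e0 : s₁.arr 0 = s.arr 0 := hf.2 0 (by simp [Program.KeepsArr, Program.for, Program.inc])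
  have e1 : s₁.arr 1 = s.arr 1 := hf.2 1 (by simp [Program.KeepsArr, Program.for, Program.inc])
  have e4 : s₁.var 4 = P := by
    rw [hf.1 4 (by simp [Program.KeepsVar, Program.for, Program.inc]), h4]
  refine (Runs.straight (by simp [Program.Straight]) ?_).mono
    (by simp [Program.cost, Expr.cost, Test.cost]) fun _ h => h
  intro l
  obtain ⟨i1, i2, i3, i4⟩ := hinv l
  simp only [Program.run, Test.eval_eq_iff, Expr.eval, h1, e1, e4, Nat.count_succ, Store.setArr_arr,
    Store.setArr_var, Store.setVar_arr]
  by_cases hl : s.arr 1 v = l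
  · subst hl
    split_ifs <;> simp_all <;> grind
  · split_ifs <;> simp_all [eq_comm (a := l)]

/-- Put into register `6` the number of red vertices minus the sum of array `5`. -/
def computeMissing : Program :=
  .seq (.assign 6 (.var 3)) (.for 1 (.assign 6 (.sub (.var 6) (.get 5 (.var 1)))))

theorem computeMissing_runs {s : Store} {n : ℕ} (hn : s.var 0 = n) :
    Runs computeMissing s (n * 13 + 8) fun s' =>
      s'.var 6 = s.var 3 - ∑ l ∈ Finset.range n, s.arr 5 l ∧ computeMissing.Frame s s' := by
  refine (Runs.frame (Runs.assign_seq (T := n * 13 + 6) ?_)).mono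
    (by simp only [Expr.cost]; omega) fun _ h => h
  refine (Runs.for (n := n) (T := 5)
    (fun v s' => s'.var 6 = s.var 3 - ∑ l ∈ Finset.range v, s.arr 5 l) (by simp [hn])
    (by simp) (by simp [Program.KeepsVar]) (by simp [Program.KeepsVar])
    (by simp [Expr.eval]) ?_).mono le_rfl fun _ h => h.1
  intro v hv s₂ h1 hf hinv
  have e5 : s₂.arr 5 = s.arr 5 := by
    rw [hf.2 5 (by simp [Program.KeepsArr, Program.for, Program.inc])]
    simp
  refine (Runs.straight (by simp [Program.Straight]) ?_).mono
    (by simp [Program.cost, Expr.cost]) fun _ h => h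
  simp [Program.run, Expr.eval, hinv, h1, e5, Finset.sum_range_succ, Nat.sub_sub]

end RAM

/-! ### Greedy choice of the clusters to round up. -/

namespace RAM

/-- Find in register `8` the largest unmarked cluster of residue more than half of register `4`. -/
def findLargest : Program :=
  .for 10 (.branch (.and (.lt (.var 4) (.add (.get 4 (.var 10)) (.get 4 (.var 10))))
      (.and (.lt (.var 9) (.get 3 (.var 10))) (.eq (.get 7 (.var 10)) (.lit 0))))
    (.seq (.assign 8 (.var 10)) (.assign 9 (.get 3 (.var 10)))) .skip)

/-- The starting candidate in register 8 is an unmarked label of size zero; as the comparison is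
strict, it is returned only if no unmarked cluster of large residue has positive size. -/
theorem findLargest_runs {s : Store} {n : ℕ} (hn : s.var 0 = n)
    (h7 : s.arr 7 (s.var 8) = 0) (h3 : s.arr 3 (s.var 8) = 0) (h9 : s.var 9 = 0) :
    Runs findLargest s (n * 34 + 6) fun s' =>
      (s.arr 7 (s'.var 8) = 0 ∧ (s'.var 8 = s.var 8 ∨
        (s'.var 8 < n ∧ s.var 4 < 2 * s.arr 4 (s'.var 8))) ∧
      ∀ i < n, s.var 4 < 2 * s.arr 4 i → s.arr 7 i = 0 → s.arr 3 i ≤ s.arr 3 (s'.var 8)) ∧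
        findLargest.Frame s s' := by
  refine (Runs.for (T := 26) (fun v s' => s'.var 9 = s.arr 3 (s'.var 8) ∧
      s.arr 7 (s'.var 8) = 0 ∧ (s'.var 8 = s.var 8 ∨
        (s'.var 8 < n ∧ s.var 4 < 2 * s.arr 4 (s'.var 8))) ∧
      ∀ i < v, s.var 4 < 2 * s.arr 4 i → s.arr 7 i = 0 → s.arr 3 i ≤ s.arr 3 (s'.var 8)) hn
    (by simp) (by simp [Program.KeepsVar]) (by simp [Program.KeepsVar])
    (by simp [h7, h3, h9]) ?_).mono le_rfl fun _ h => ⟨h.1.2, h.2⟩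
  rintro v hv s₁ h1 hf ⟨i1, i2, i3, i4⟩
  have e3 : s₁.arr 3 = s.arr 3 := hf.2 3 (by simp [Program.KeepsArr, Program.for, Program.inc])
  have e4 : s₁.arr 4 = s.arr 4 := hf.2 4 (by simp [Program.KeepsArr, Program.for, Program.inc])
  have e7 : s₁.arr 7 = s.arr 7 := hf.2 7 (by simp [Program.KeepsArr, Program.for, Program.inc])
  have ev : s₁.var 4 = s.var 4 := hf.1 4 (by simp [Program.KeepsVar, Program.for, Program.inc])
  refine (Runs.straight (by simp [Program.Straight]) ?_).mono
    (by simp [Program.cost, Expr.cost, Test.cost]) fun _ h => h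
  simp only [Program.run, Test.eval_eq_iff, Test.eval_lt_iff, Test.eval_and_iff, Expr.eval, h1, e3, e4, e7, ev, i1]
  split_ifs with h
  · simp only [Store.setVar_var, Store.setVar_arr, e3, Function.update_self, ne_eq,
      Nat.reduceEqDiff, not_false_eq_true, Function.update_of_ne, h1]
    refine ⟨trivial, h.2.2, Or.inr ⟨hv, by omega⟩, fun i hi hh hm => ?_⟩
    rcases Nat.lt_succ_iff_lt_or_eq.1 hi with hi | rfl
    · exact (i4 i hi hh hm).trans h.2.1.le
    · exact le_rfl
  · simp only [Store.setVar_var, ne_eq, Nat.reduceEqDiff, not_false_eq_true,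
      Function.update_of_ne]
    refine ⟨i1, i2, i3, fun i hi hh hm => ?_⟩
    rcases Nat.lt_succ_iff_lt_or_eq.1 hi with hi | rfl
    · exact i4 i hi hh hm
    · by_contra hcon
      exact h ⟨by omega, by omega, hm⟩

/-- As many times as register `6` says, mark the largest unmarked cluster of large residue, or an
unused label if there is none, and increase its quotas. -/
def roundUp : Program :=
  .seq (.assign 7 (.var 0)) (.loop (.lt (.lit 0) (.var 6))
    (.seq (.assign 6 (.sub (.var 6) (.lit 1))) (.seq (.assign 8 (.var 7)) (.seq (.assign 9 (.lit 0))
      (.seq findLargest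
        (.seq (.put 7 (.var 8) (.lit 1))
          (.seq (.put 5 (.var 8) (.add (.get 5 (.var 8)) (.lit 1)))
            (.seq (.put 6 (.var 8) (.add (.get 6 (.var 8)) (.var 4))) (.inc 7)))))))))

/-- Always taking the largest remaining cluster keeps every marked cluster at least as large as each
unmarked heavy one. With at most `n` rounds, the spare labels stay below `n + n`. -/
theorem roundUp_runs {s : Store} {n M : ℕ} (hn : s.var 0 = n) (hM : s.var 6 = M) (hMn : M ≤ n)
    (a7 : s.arr 7 = 0) (h3 : ∀ l, n ≤ l → s.arr 3 l = 0) (h4 : ∀ l, n ≤ l → s.arr 4 l = 0) :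
    Runs roundUp s (n * (n * 34 + 38) + 6) fun s' =>
      (∃ U : Finset ℕ, U.card = M ∧ Greedy (s.var 4) (n + n) (s.arr 3) (s.arr 4) U ∧
        ∀ l, s'.arr 5 l = s.arr 5 l + (if l ∈ U then 1 else 0) ∧
          s'.arr 6 l = s.arr 6 l + (if l ∈ U then s.var 4 else 0)) ∧ roundUp.Frame s s' := by
  refine (Runs.frame (Runs.assign_seq (T := n * (n * 34 + 38) + 4) ?_)).mono
    (by simp only [Expr.cost]; omega) fun _ h => h
  refine (Runs.loop (m := n) (T := 4 + (2 + (2 + (n * 34 + 6 + 20)))) (fun s' => ∃ U : Finset ℕ,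
      s'.var 6 + U.card = M ∧ s'.var 7 = n + U.card ∧ (∀ j ∈ U, j < n + U.card) ∧
      (∀ j ∈ U, s.var 4 < 2 * s.arr 4 j ∨ s.arr 3 j = 0) ∧
      (∀ i < n, i ∉ U → s.var 4 < 2 * s.arr 4 i → ∀ j ∈ U, s.arr 3 i ≤ s.arr 3 j) ∧
      ∀ l, (s'.arr 7 l = 0 ↔ l ∉ U) ∧ s'.arr 5 l = s.arr 5 l + (if l ∈ U then 1 else 0) ∧
        s'.arr 6 l = s.arr 6 l + (if l ∈ U then s.var 4 else 0)) (fun s' => s'.var 6) ?_ ?_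
      ?_).mono ?_ ?_
  · exact ⟨∅, by simp [hM, Expr.eval, hn, a7]⟩
  · simp [hM, hMn]
  · rintro s₁ hf ⟨U, i1, i2, i3, i4, i5, i6⟩ hb
    have e0 : s₁.var 0 = n := by
      rw [hf.1 0 (by simp [Program.KeepsVar, Program.inc, findLargest, Program.for])]; simp [hn]
    have e4 : s₁.var 4 = s.var 4 := by
      rw [hf.1 4 (by simp [Program.KeepsVar, Program.inc, findLargest, Program.for])]; simp
    have f3 : s₁.arr 3 = s.arr 3 := by
      rw [hf.2 3 (by simp [Program.KeepsArr, Program.inc, findLargest, Program.for])]; simp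
    have f4 : s₁.arr 4 = s.arr 4 := by
      rw [hf.2 4 (by simp [Program.KeepsArr, Program.inc, findLargest, Program.for])]; simp
    have hpos : 0 < s₁.var 6 := by simpa [Test.eval_lt_iff, Expr.eval] using hb
    -- Register 7 advances in every round, even if its label was not used, so it exceeds all marked
    -- labels and serves as the empty fallback candidate.
    have hfresh : n + U.card ∉ U := fun h => (i3 _ h).false
    refine Runs.assign_seq (Runs.assign_seq (Runs.assign_seq ?_))
    generalize hs₂ : Store.setVar _ 9 _ = s₂
    have g8 : s₂.var 8 = n + U.card := by simp [← hs₂, Expr.eval, i2]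
    have g7 : s₂.arr 7 = s₁.arr 7 := by simp [← hs₂]
    have g3 : s₂.arr 3 = s.arr 3 := by simp [← hs₂, f3]
    have g4 : s₂.arr 4 = s.arr 4 := by simp [← hs₂, f4]
    have gv4 : s₂.var 4 = s.var 4 := by simp [← hs₂, e4]
    refine Runs.seq (findLargest_runs (n := n) (by simp [← hs₂, e0]) ?_ ?_ ?_)
      fun s₃ ⟨⟨j1, j2, j3⟩, hf₃⟩ => ?_
    · rw [g7, g8]; exact (i6 _).1.2 hfresh
    · rw [g3, g8]; exact h3 _ (Nat.le_add_right _ _)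
    · simp [← hs₂, Expr.eval]
    have k5 : s₃.arr 5 = s₁.arr 5 := by
      rw [hf₃.2 5 (by simp [Program.KeepsArr, Program.inc, findLargest, Program.for]), ← hs₂]; simp
    have k6 : s₃.arr 6 = s₁.arr 6 := by
      rw [hf₃.2 6 (by simp [Program.KeepsArr, Program.inc, findLargest, Program.for]), ← hs₂]; simp
    have k7 : s₃.arr 7 = s₁.arr 7 := by
      rw [hf₃.2 7 (by simp [Program.KeepsArr, Program.inc, findLargest, Program.for]), ← hs₂]; simp
    have kv6 : s₃.var 6 = s₁.var 6 - 1 := by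
      rw [hf₃.1 6 (by simp [Program.KeepsVar, Program.inc, findLargest, Program.for]), ← hs₂]
      simp [Expr.eval]
    have kv7 : s₃.var 7 = n + U.card := by
      rw [hf₃.1 7 (by simp [Program.KeepsVar, Program.inc, findLargest, Program.for]), ← hs₂]
      simp [i2]
    have kv4 : s₃.var 4 = s.var 4 := by
      rw [hf₃.1 4 (by simp [Program.KeepsVar, Program.inc, findLargest, Program.for]), gv4]
    rw [g8, gv4, g4] at j2
    rw [gv4, g4, g3, g7] at j3
    rw [g7] at j1
    refine (Runs.straight (by simp [Program.Straight, Program.inc]) ?_).mono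
      (by simp [Program.cost, Program.inc, Expr.cost]) fun _ h => h
    simp only [Program.run, Program.inc, Expr.eval, Store.setVar_var, Store.setVar_arr,
      Store.setArr_var, Store.setArr_arr, Function.update_self, ne_eq, Nat.reduceEqDiff,
      not_false_eq_true, Function.update_of_ne, k5, k6, k7, kv6, kv7, kv4]
    generalize s₃.var 8 = b at *
    have hbU : b ∉ U := (i6 b).1.1 j1
    have hcard : (insert b U).card = U.card + 1 := Finset.card_insert_of_notMem hbU
    refine ⟨⟨insert b U, by omega, by omega, fun j hj => ?_, fun j hj => ?_,
      fun i hi hiU hh j hj => ?_, fun l => ?_⟩, by omega⟩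
    · rcases Finset.mem_insert.1 hj with rfl | hj
      · omega
      · have := i3 j hj
        omega
    · rcases Finset.mem_insert.1 hj with rfl | hj
      · rcases j2 with rfl | ⟨_, h⟩
        · exact .inr (h3 _ (Nat.le_add_right _ _))
        · exact .inl h
      · exact i4 j hj
    · rw [Finset.mem_insert, not_or] at hiU
      rcases Finset.mem_insert.1 hj with rfl | hj
      · exact j3 i hi hh ((i6 i).1.2 hiU.2)
      · exact i5 i hi hiU.2 hh j hj
    · obtain ⟨l1, l2, l3⟩ := i6 l
      rcases eq_or_ne l b with rfl | hl
      · simp [l2, l3, hbU]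
      · simp [hl, l1, l2, l3]
  · simp only [Expr.cost, Test.cost]
    nlinarith
  · rintro s' ⟨⟨⟨U, i1, i2, i3, i4, i5, i6⟩, hb⟩, -⟩
    have h6 : s'.var 6 = 0 := by simpa [Test.eval_lt_eq_false_iff, Expr.eval] using hb
    refine ⟨U, by omega, ⟨fun j hj => ?_, i4, fun i hi hiU hh => ?_⟩, fun l => (i6 l).2⟩
    · have := i3 j hj
      exact Finset.mem_range.2 (by omega)
    · rcases lt_or_ge i n with h | h
      · exact i5 i h hiU hh
      · have := h4 i h
        omega

/-! ### Redistributing the vertices of one colour according to quotas. -/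

/-- Let the vertices of colour `x` keep their labels as long as the quotas in array `q` permit.  The
new labels, increased by one, are put into array `8`. -/
def keepLabels (x q : ℕ) : Program :=
  .for 1 (.branch (.and (.eq (.get 0 (.var 1)) (.lit x)) (.lt (.lit 0) (.get q (.get 1 (.var 1)))))
    (.seq (.put 8 (.var 1) (.add (.get 1 (.var 1)) (.lit 1)))
      (.put q (.get 1 (.var 1)) (.sub (.get q (.get 1 (.var 1))) (.lit 1)))) .skip)

/-- Give labels to the vertices of colour `x` that have none, using up the quotas in array `q`. -/
def fillQuotas (x q : ℕ) : Program :=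
  .seq (.assign 1 (.lit 0)) (.seq (.assign 11 (.lit 0)) (.loop (.lt (.var 1) (.var 0))
    (.branch (.and (.eq (.get 0 (.var 1)) (.lit x)) (.eq (.get 8 (.var 1)) (.lit 0)))
      (.branch (.lt (.lit 0) (.get q (.var 11)))
        (.seq (.put 8 (.var 1) (.add (.var 11) (.lit 1)))
          (.seq (.put q (.var 11) (.sub (.get q (.var 11)) (.lit 1))) (.inc 1)))
        (.inc 11))
      (.inc 1))))

theorem keepLabels_runs {s : Store} {n x q N : ℕ} (hq : q ≠ 0 ∧ q ≠ 1 ∧ q ≠ 8) (hn : s.var 0 = n)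
    (hlab : ∀ u < n, s.arr 1 u < N)
    (h8 : ∀ u < n, s.arr 0 u = x → s.arr 8 u = 0)
    (hsum : ∑ l ∈ Finset.range N, s.arr q l = Nat.count (fun u => s.arr 0 u = x) n) :
    Runs (keepLabels x q) s (n * 35 + 6) fun s' =>
      ((∀ l, s'.arr q l + Nat.count (fun u => s.arr 0 u = x ∧ s'.arr 8 u = l + 1) n = s.arr q l) ∧
      (∑ l ∈ Finset.range N, s'.arr q l + Nat.count (fun u => s.arr 0 u = x ∧ 0 < s'.arr 8 u) n =
        Nat.count (fun u => s.arr 0 u = x) n) ∧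
      (∀ l, min (s.arr q l) (Nat.count (fun u => s.arr 0 u = x ∧ s.arr 1 u = l) n) ≤
        Nat.count (fun u => s.arr 0 u = x ∧ s.arr 1 u = l ∧ s'.arr 8 u = l + 1) n) ∧
      (∀ u < n, s.arr 0 u = x → s'.arr 8 u ≤ N) ∧
      (∀ u < n, s.arr 0 u ≠ x → s'.arr 8 u = s.arr 8 u)) ∧ (keepLabels x q).Frame s s' := by
  refine (Runs.for (T := 27) (fun v s' =>
    -- Truncated subtraction is exactly the remaining quota. Together with the next clause it yields
    -- that `min` of quota and cluster count many vertices keep the label `l`.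
    (∀ l, s'.arr q l = s.arr q l - Nat.count (fun u => s.arr 0 u = x ∧ s.arr 1 u = l) v) ∧
    (∀ l, s'.arr q l + Nat.count (fun u => s.arr 0 u = x ∧ s'.arr 8 u = l + 1) n = s.arr q l) ∧
    (∑ l ∈ Finset.range N, s'.arr q l + Nat.count (fun u => s.arr 0 u = x ∧ 0 < s'.arr 8 u) n =
        Nat.count (fun u => s.arr 0 u = x) n) ∧
    (∀ u < n, s.arr 0 u = x → s'.arr 8 u ≠ 0 → s'.arr 8 u = s.arr 1 u + 1) ∧
    (∀ u < n, v ≤ u → s.arr 0 u = x → s'.arr 8 u = 0) ∧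
    (∀ u < n, s.arr 0 u ≠ x → s'.arr 8 u = s.arr 8 u)) hn
    (by simp) (by simp [Program.KeepsVar]) (by simp [Program.KeepsVar]) ?_ ?_).mono le_rfl ?_
  · have hc : ∀ l, Nat.count (fun u => s.arr 0 u = x ∧ s.arr 8 u = l + 1) n = 0 := fun l => by
      rw [count_congr_of_lt (q := fun _ => False) fun u hu => by
        simp only [iff_false, not_and]; intro h; rw [h8 u hu h]; omega]
      simp
    have hc' : Nat.count (fun u => s.arr 0 u = x ∧ 0 < s.arr 8 u) n = 0 := by
      rw [count_congr_of_lt (q := fun _ => False) fun u hu => by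
        simp only [iff_false, not_and]; intro h; rw [h8 u hu h]; omega]
      simp
    exact ⟨fun l => rfl, fun l => congrArg (s.arr q l + ·) (hc l),
      (congrArg₂ (· + ·) hsum hc').trans (add_zero _), fun u hu hx h => absurd (h8 u hu hx) h,
      fun u hu _ hx => h8 u hu hx, fun u hu _ => rfl⟩
  · rintro v hv s₁ h1 hf ⟨i1, i2, i3, i4, i5, i6⟩
    have e0 : s₁.arr 0 = s.arr 0 :=
      hf.2 0 (by simp [Program.KeepsArr, Program.for, Program.inc, hq.1.symm])
    have e1 : s₁.arr 1 = s.arr 1 :=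
      hf.2 1 (by simp [Program.KeepsArr, Program.for, Program.inc, hq.2.1.symm])
    refine (Runs.straight (by simp [Program.Straight]) ?_).mono
      (by simp [Program.cost, Expr.cost, Test.cost]) fun _ h => h
    simp only [Program.run, Test.eval_eq_iff, Test.eval_lt_iff, Test.eval_and_iff, Expr.eval, h1, e0, e1]
    split_ifs with h
    · obtain ⟨hx, hpos⟩ := h
      have hv8 : s₁.arr 8 v = 0 := i5 v hv le_rfl hx
      simp only [Store.setVar_arr, Store.setArr_arr, Store.setArr_var, h1, e1,
        Function.update_self, Function.update_of_ne hq.2.2, Function.update_of_ne hq.2.2.symm,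
        ne_eq, not_false_eq_true, OfNat.one_ne_ofNat, Function.update_of_ne]
      have hB := count_update_of_not (R := fun u y => s.arr 0 u = x ∧ 0 < y) (L := s₁.arr 8)
        (x := s.arr 1 v + 1) hv (fun h => by omega) ⟨hx, Nat.succ_pos _⟩
      have hS := sum_range_update (s₁.arr q) (s₁.arr q (s.arr 1 v) - 1) (hlab v hv)
      refine ⟨fun l => ?_, fun l => ?_, ?_, fun u hu hxu => ?_, fun u hu hvu hxu => ?_,
        fun u hu hxu => ?_⟩
      · rw [Nat.count_succ]
        have := i1 l
        rcases eq_or_ne l (s.arr 1 v) with rfl | hl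
        · simp only [Function.update_self, hx, and_self, if_true]; omega
        · simp only [Function.update_of_ne hl, hl.symm, and_false, if_false]; omega
      · have := i2 l
        rcases eq_or_ne l (s.arr 1 v) with rfl | hl
        · have hA := count_update_of_not (R := fun u y => s.arr 0 u = x ∧ y = s.arr 1 v + 1)
            (L := s₁.arr 8) (x := s.arr 1 v + 1) hv (fun h => by omega) ⟨hx, rfl⟩
          rw [Function.update_self]; omega
        · have hA := count_update_of_not_of_not (R := fun u y => s.arr 0 u = x ∧ y = l + 1)
            (L := s₁.arr 8) (x := s.arr 1 v + 1) hv (fun h => by omega) (fun h => by omega)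
          rw [Function.update_of_ne hl]; omega
      · omega
      · rcases eq_or_ne u v with rfl | hne
        · simp
        · simpa [Function.update_of_ne hne] using i4 u hu hxu
      · rw [Function.update_of_ne (by omega)]
        exact i5 u hu (by omega) hxu
      · rw [Function.update_of_ne (by rintro rfl; exact hxu hx)]
        exact i6 u hu hxu
    · simp only [Store.setVar_arr]
      refine ⟨fun l => ?_, i2, i3, i4, fun u hu hvu => i5 u hu (by omega), i6⟩
      rw [Nat.count_succ]
      have := i1 l
      split_ifs with hl
      · obtain ⟨hx, rfl⟩ := hl
        have : ¬ 0 < s₁.arr q (s.arr 1 v) := fun h' => h ⟨hx, h'⟩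
        omega
      · omega
  · rintro s' ⟨⟨i1, i2, i3, i4, i5, i6⟩, hf⟩
    refine ⟨⟨i2, i3, fun l => ?_, fun u hu hx => ?_, i6⟩, hf⟩
    swap
    · have := i4 u hu hx
      have := hlab u hu
      omega
    have h : Nat.count (fun u => s.arr 0 u = x ∧ s.arr 1 u = l ∧ s'.arr 8 u = l + 1) n =
        Nat.count (fun u => s.arr 0 u = x ∧ s'.arr 8 u = l + 1) n :=
      count_congr_of_lt fun u hu => by
        constructor
        · rintro ⟨h1, h2, h3⟩; exact ⟨h1, h3⟩
        · rintro ⟨h1, h3⟩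
          have := i4 u hu h1 (by omega)
          exact ⟨h1, by omega, h3⟩
    rw [h]
    have := i1 l
    have := i2 l
    omega

/-- Two pointers, one over vertices and one over labels; each round advances one of them, which
gives linear time. Existing labels are never overwritten, so any lower bound `m` on the kept
vertices survives. -/
theorem fillQuotas_runs {s : Store} {n x q N : ℕ} {Q m : ℕ → ℕ} (hq : q ≠ 0 ∧ q ≠ 1 ∧ q ≠ 8)
    (hn : s.var 0 = n)
    (hQ : ∀ l, s.arr q l + Nat.count (fun u => s.arr 0 u = x ∧ s.arr 8 u = l + 1) n = Q l)
    (hQN : ∀ l, N ≤ l → Q l = 0)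
    (hsum : ∑ l ∈ Finset.range N, s.arr q l + Nat.count (fun u => s.arr 0 u = x ∧ 0 < s.arr 8 u) n =
        Nat.count (fun u => s.arr 0 u = x) n)
    (hm : ∀ l, m l ≤ Nat.count (fun u => s.arr 0 u = x ∧ s.arr 1 u = l ∧ s.arr 8 u = l + 1) n)
    (h8 : ∀ u < n, s.arr 0 u = x → s.arr 8 u ≤ N) :
    Runs (fillQuotas x q) s ((n + N) * 42 + 8) fun s' =>
      ((∀ l, Nat.count (fun u => s.arr 0 u = x ∧ s'.arr 8 u = l + 1) n = Q l) ∧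
      (∀ l, m l ≤ Nat.count (fun u => s.arr 0 u = x ∧ s.arr 1 u = l ∧ s'.arr 8 u = l + 1) n) ∧
      (∀ u < n, s.arr 0 u = x → 0 < s'.arr 8 u ∧ s'.arr 8 u ≤ N) ∧
      (∀ u < n, s.arr 0 u ≠ x → s'.arr 8 u = s.arr 8 u)) ∧ (fillQuotas x q).Frame s s' := by
  refine (Runs.frame (Runs.assign_seq (Runs.assign_seq (T := (n + N) * 42 + 4) ?_))).mono
    (by simp only [Expr.cost]; omega) fun _ h => h
  refine (Runs.loop (m := n + N) (T := 38) (fun s' =>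
    (∀ l, s'.arr q l + Nat.count (fun u => s.arr 0 u = x ∧ s'.arr 8 u = l + 1) n = Q l) ∧
    (∑ l ∈ Finset.range N, s'.arr q l + Nat.count (fun u => s.arr 0 u = x ∧ 0 < s'.arr 8 u) n =
        Nat.count (fun u => s.arr 0 u = x) n) ∧
    (∀ l, m l ≤ Nat.count (fun u => s.arr 0 u = x ∧ s.arr 1 u = l ∧ s'.arr 8 u = l + 1) n) ∧
    (∀ u < n, s.arr 0 u = x → s'.arr 8 u ≤ N) ∧
    (∀ u < n, s.arr 0 u ≠ x → s'.arr 8 u = s.arr 8 u) ∧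
    (∀ u < s'.var 1, s.arr 0 u = x → 0 < s'.arr 8 u) ∧
    (∀ l < s'.var 11, s'.arr q l = 0) ∧ s'.var 1 ≤ n ∧ s'.var 11 ≤ N)
    (fun s' => (n - s'.var 1) + (N - s'.var 11)) ?_ ?_ ?_).mono ?_ ?_
  · exact ⟨hQ, hsum, hm, h8, fun _ _ _ => rfl, fun u hu => absurd hu (Nat.not_lt_zero u),
      fun u hu => absurd hu (Nat.not_lt_zero u), Nat.zero_le _, Nat.zero_le _⟩
  · omega
  · rintro s₁ hf ⟨i1, i2, i3, i4, i5, i6, i7, i8, i9⟩ hb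
    have e0 : s₁.var 0 = n := by
      rw [hf.1 0 (by simp [Program.KeepsVar, Program.inc])]; simp [hn]
    have f0 : s₁.arr 0 = s.arr 0 := by
      rw [hf.2 0 (by simp [Program.KeepsArr, Program.inc, hq.1.symm])]; simp
    have f1 : s₁.arr 1 = s.arr 1 := by
      rw [hf.2 1 (by simp [Program.KeepsArr, Program.inc, hq.2.1.symm])]; simp
    have hlt : s₁.var 1 < n := by simpa [Test.eval_lt_iff, Expr.eval, e0] using hb
    refine (Runs.straight (by simp [Program.Straight, Program.inc]) ?_).mono
      (by simp [Program.cost, Program.inc, Expr.cost, Test.cost]) fun _ h => h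
    simp only [Program.run, Program.inc, Test.eval_eq_iff, Test.eval_lt_iff, Test.eval_and_iff, Expr.eval, f0]
    split_ifs with h h'
    · obtain ⟨hx, hv8⟩ := h
      simp only [Store.setVar_var, Store.setVar_arr, Store.setArr_var, Store.setArr_arr,
        Function.update_self, Function.update_of_ne hq.2.2, Function.update_of_ne hq.2.2.symm,
        ne_eq, not_false_eq_true, Nat.reduceEqDiff, Function.update_of_ne]
      generalize s₁.var 1 = v at *
      generalize s₁.var 11 = p at *
      have hpN : p < N := by
        by_contra hcon
        have := i1 p
        have := hQN p (not_lt.1 hcon)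
        omega
      have hB := count_update_of_not (R := fun u y => s.arr 0 u = x ∧ 0 < y) (L := s₁.arr 8)
        (x := p + 1) hlt (fun h => by omega) ⟨hx, Nat.succ_pos _⟩
      have hS := sum_range_update (s₁.arr q) (s₁.arr q p - 1) hpN
      refine ⟨⟨fun l => ?_, by omega, fun l => (i3 l).trans (count_le_of_imp fun u hu hl => ?_),
        fun u hu hxu => ?_, fun u hu hxu => ?_, fun u hu hxu => ?_, fun l hl => ?_, hlt, i9⟩,
        by omega⟩
      · have := i1 l
        rcases eq_or_ne l p with rfl | hl
        · have hA := count_update_of_not (R := fun u y => s.arr 0 u = x ∧ y = l + 1)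
            (L := s₁.arr 8) (x := l + 1) hlt (fun h => by omega) ⟨hx, rfl⟩
          rw [Function.update_self]; omega
        · have hA := count_update_of_not_of_not (R := fun u y => s.arr 0 u = x ∧ y = l + 1)
            (L := s₁.arr 8) (x := p + 1) hlt (fun h => by omega) (fun h => by omega)
          rw [Function.update_of_ne hl]; omega
      · rw [Function.update_of_ne (by rintro rfl; omega)]
        exact hl
      · rcases eq_or_ne u v with rfl | hne
        · rw [Function.update_self]; omega
        · rw [Function.update_of_ne hne]; exact i4 u hu hxu
      · rw [Function.update_of_ne (by rintro rfl; exact hxu hx)]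
        exact i5 u hu hxu
      · rcases eq_or_ne u v with rfl | hne
        · rw [Function.update_self]; omega
        · rw [Function.update_of_ne hne]; exact i6 u (by omega) hxu
      · rw [Function.update_of_ne hl.ne]
        exact i7 l hl
    · obtain ⟨hx, hv8⟩ := h
      simp only [Store.setVar_var, Store.setVar_arr, Function.update_self, ne_eq, not_false_eq_true,
        OfNat.one_ne_ofNat, Function.update_of_ne]
      -- Otherwise all quotas are exhausted, and by the balance of quotas and labelled vertices
      -- every vertex of colour `x` has a label already, contrary to the current one.
      have hpN : s₁.var 11 < N := by
        by_contra hcon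
        have h0 : ∑ l ∈ Finset.range N, s₁.arr q l = 0 := Finset.sum_eq_zero fun l hl =>
          i7 l ((Finset.mem_range.1 hl).trans_le (not_lt.1 hcon))
        rw [h0, zero_add, Nat.count_eq_card_filter_range, Nat.count_eq_card_filter_range] at i2
        have hsub := Finset.eq_of_subset_of_card_le
          (Finset.monotone_filter_right (Finset.range n)
            (fun u _ (h : s.arr 0 u = x ∧ 0 < s₁.arr 8 u) => h.1)) i2.ge
        have hmem : s₁.var 1 ∈ (Finset.range n).filter fun u => s.arr 0 u = x :=
          Finset.mem_filter.2 ⟨Finset.mem_range.2 hlt, hx⟩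
        rw [← hsub] at hmem
        have := (Finset.mem_filter.1 hmem).2.2
        omega
      refine ⟨⟨i1, i2, i3, i4, i5, i6, fun l hl => ?_, i8, hpN⟩, by omega⟩
      rcases Nat.lt_succ_iff_lt_or_eq.1 hl with hl | rfl
      · exact i7 l hl
      · omega
    · simp only [Store.setVar_var, Store.setVar_arr, Function.update_self, ne_eq, not_false_eq_true,
        Nat.reduceEqDiff, Function.update_of_ne]
      refine ⟨⟨i1, i2, i3, i4, i5, fun u hu hxu => ?_, i7, hlt, i9⟩, by omega⟩
      rcases Nat.lt_succ_iff_lt_or_eq.1 hu with hu | rfl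
      · exact i6 u hu hxu
      · exact Nat.pos_of_ne_zero fun h0 => h ⟨hxu, h0⟩
  · simp only [Expr.cost, Test.cost]
    omega
  · rintro s' ⟨⟨⟨i1, i2, i3, i4, i5, i6, i7, i8, i9⟩, hb⟩, hf⟩
    have e0 : s'.var 0 = n := by
      rw [hf.1 0 (by simp [Program.KeepsVar, Program.inc])]; simp [hn]
    have hge : n ≤ s'.var 1 := by simpa [Test.eval_lt_eq_false_iff, Expr.eval, e0] using hb
    have hall : ∀ u < n, s.arr 0 u = x → 0 < s'.arr 8 u := fun u hu => i6 u (hu.trans_le hge)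
    refine ⟨fun l => ?_, i3, fun u hu hx => ⟨hall u hu hx, i4 u hu hx⟩, i5⟩
    rw [count_congr_of_lt (q := fun u => s.arr 0 u = x)
      fun u hu => ⟨fun h => h.1, fun h => ⟨h, hall u hu h⟩⟩] at i2
    have h0 : ∑ l ∈ Finset.range N, s'.arr q l = 0 := by omega
    have := i1 l
    rcases lt_or_ge l N with hl | hl
    · have := Finset.sum_eq_zero_iff.1 h0 l (Finset.mem_range.2 hl)
      omega
    · have := hQN l hl
      omega

/-- Give new labels to the vertices of colour `x`, with quotas in array `q`. -/
def relabel (x q : ℕ) : Program := .seq (keepLabels x q) (fillQuotas x q)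

theorem relabel_runs {s : Store} {n x q N : ℕ} (hq : q ≠ 0 ∧ q ≠ 1 ∧ q ≠ 8) (hn : s.var 0 = n)
    (hlab : ∀ u < n, s.arr 1 u < N) (h8 : ∀ u < n, s.arr 0 u = x → s.arr 8 u = 0)
    (hQN : ∀ l, N ≤ l → s.arr q l = 0)
    (hsum : ∑ l ∈ Finset.range N, s.arr q l = Nat.count (fun u => s.arr 0 u = x) n) :
    Runs (relabel x q) s (n * 35 + 6 + ((n + N) * 42 + 8)) fun s' =>
      ((∀ l, Nat.count (fun u => s.arr 0 u = x ∧ s'.arr 8 u = l + 1) n = s.arr q l) ∧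
      (∀ l, Nat.count (fun u => s.arr 0 u = x ∧ s.arr 1 u = l ∧ s'.arr 8 u = l + 1) n =
        min (s.arr q l) (Nat.count (fun u => s.arr 0 u = x ∧ s.arr 1 u = l) n)) ∧
      (∀ u < n, s.arr 0 u = x → 0 < s'.arr 8 u ∧ s'.arr 8 u ≤ N) ∧
      (∀ u < n, s.arr 0 u ≠ x → s'.arr 8 u = s.arr 8 u)) ∧ (relabel x q).Frame s s' := by
  refine (Runs.frame (Runs.seq (keepLabels_runs hq hn hlab h8 hsum) ?_)).mono le_rfl fun _ h => h
  rintro s₁ ⟨⟨i1, i2, i3, i4, i5⟩, hf⟩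
  have e0 : s₁.var 0 = n := by
    rw [hf.1 0 (by simp [keepLabels, Program.KeepsVar, Program.for, Program.inc]), hn]
  have f0 : s₁.arr 0 = s.arr 0 :=
    hf.2 0 (by simp [keepLabels, Program.KeepsArr, Program.for, Program.inc, hq.1.symm])
  have f1 : s₁.arr 1 = s.arr 1 :=
    hf.2 1 (by simp [keepLabels, Program.KeepsArr, Program.for, Program.inc, hq.2.1.symm])
  rw [← f0] at i1 i2 i4 i5
  refine (fillQuotas_runs (m := fun l => min (s.arr q l)
    (Nat.count (fun u => s.arr 0 u = x ∧ s.arr 1 u = l) n)) hq e0 i1 hQN i2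
    (by simpa only [f0, f1] using i3) i4).mono le_rfl ?_
  rintro s' ⟨⟨j1, j2, j3, j4⟩, -⟩
  simp only [f0, f1] at j1 j2 j3 j4 i5
  refine ⟨j1, fun l => le_antisymm (le_min ?_ ?_) (j2 l), j3, fun u hu hx =>
    (j4 u hu hx).trans (i5 u hu hx)⟩
  · rw [← j1 l]
    exact count_le_of_imp fun u _ h => ⟨h.1, h.2.2⟩
  · exact count_le_of_imp fun u _ h => ⟨h.1, h.2.1⟩

/-- Replace the labels in array `8` by vertices of the same cluster, and put them into array `2`. -/
def output : Program :=
  .seq (.for 1 (.put 9 (.get 8 (.var 1)) (.var 1)))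
    (.for 1 (.put 2 (.var 1) (.get 9 (.get 8 (.var 1)))))

/-- Internal labels may exceed `n`. Each is replaced by the last vertex that carries it, a
representative in the admissible range. -/
theorem output_runs {s : Store} {n : ℕ} (hn : s.var 0 = n) :
    Runs output s (n * 12 + 6 + (n * 13 + 6)) fun s' =>
      (∀ u < n, s'.arr 2 u < n) ∧
        ∀ u < n, ∀ v < n, s'.arr 2 u = s'.arr 2 v ↔ s.arr 8 u = s.arr 8 v := by
  refine Runs.seq (Runs.for (T := 4)
    (fun v s' => ∀ u < v, s'.arr 9 (s.arr 8 u) < v ∧ s.arr 8 (s'.arr 9 (s.arr 8 u)) = s.arr 8 u)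
    hn (by simp) (by simp [Program.KeepsVar]) (by simp [Program.KeepsVar]) (by simp) ?_) ?_
  · intro v hv s₁ h1 hf hinv
    have e8 : s₁.arr 8 = s.arr 8 := hf.2 8 (by simp [Program.KeepsArr, Program.for, Program.inc])
    refine (Runs.straight (by simp [Program.Straight]) ?_).mono
      (by simp [Program.cost, Expr.cost]) fun _ h => h
    simp only [Program.run, Expr.eval, h1, e8, Store.setVar_arr, Store.setArr_arr,
      Function.update_self]
    intro u hu
    by_cases h : s.arr 8 u = s.arr 8 v
    · rw [h, Function.update_self]
      exact ⟨Nat.lt_succ_self v, rfl⟩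
    · rw [Function.update_of_ne h]
      have hne : u ≠ v := by rintro rfl; exact h rfl
      have := hinv u (by omega)
      exact ⟨by omega, this.2⟩
  · rintro s₁ ⟨hinv, hf⟩
    have e0 : s₁.var 0 = n := by
      rw [hf.1 0 (by simp [Program.KeepsVar, Program.for, Program.inc]), hn]
    have e8 : s₁.arr 8 = s.arr 8 := hf.2 8 (by simp [Program.KeepsArr, Program.for, Program.inc])
    refine (Runs.for (T := 5) (fun v s' => ∀ u < v, s'.arr 2 u = s₁.arr 9 (s.arr 8 u))
      e0 (by simp) (by simp [Program.KeepsVar]) (by simp [Program.KeepsVar]) (by simp) ?_).mono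
      le_rfl ?_
    · intro v hv s₂ h1 hf₂ hinv₂
      have f8 : s₂.arr 8 = s.arr 8 := by
        rw [hf₂.2 8 (by simp [Program.KeepsArr, Program.for, Program.inc]), e8]
      have f9 : s₂.arr 9 = s₁.arr 9 :=
        hf₂.2 9 (by simp [Program.KeepsArr, Program.for, Program.inc])
      refine (Runs.straight (by simp [Program.Straight]) ?_).mono
        (by simp [Program.cost, Expr.cost]) fun _ h => h
      simp only [Program.run, Expr.eval, h1, f8, f9, Store.setVar_arr, Store.setArr_arr,
        Function.update_self]
      intro u hu
      rcases Nat.lt_succ_iff_lt_or_eq.1 hu with hu | rfl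
      · rw [Function.update_of_ne hu.ne]; exact hinv₂ u hu
      · rw [Function.update_self]
    · rintro s' ⟨h, -⟩
      refine ⟨fun u hu => ?_, fun u hu v hv => ?_⟩
      · rw [h u hu]; exact (hinv u hu).1
      · rw [h u hu, h v hv]
        refine ⟨fun he => ?_, fun he => by rw [he]⟩
        rw [← (hinv u hu).2, ← (hinv v hv).2, he]

end RAM

section Counting

open Finset

theorem card_filter_fin (p : ℕ → Prop) [DecidablePred p] (n : ℕ) :
    #{v : Fin n | p v} = Nat.count p n := by
  rw [Nat.count_eq_card_filter_range, card_filter, card_filter]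
  exact Fin.sum_univ_eq_sum_range (fun i => if p i then 1 else 0) n

theorem sum_count_eq {p : ℕ → Prop} [DecidablePred p] {f : ℕ → ℕ} {n N : ℕ}
    (hf : ∀ u < n, f u < N) :
    ∑ l ∈ range N, Nat.count (fun u => p u ∧ f u = l) n = Nat.count p n := by
  rw [Nat.count_eq_card_filter_range p, card_eq_sum_card_fiberwise (f := f) (t := range N)
    fun u hu => mem_coe.2 (mem_range.2 (hf u (mem_range.1 (mem_filter.1 hu).1)))]
  refine sum_congr rfl fun l _ => ?_
  rw [Nat.count_eq_card_filter_range, filter_filter]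

end Counting

/-! ### The whole program. -/

namespace RAM

/-- The algorithm: round the numbers of blue vertices of the clusters to multiples of the ratio of
the colours, and move as few vertices as possible. -/
def fairClustering : Program :=
  .seq countBlue (.seq computeRatio (.seq countClusters (.seq computeMissing (.seq roundUp
    (.seq (relabel 1 6) (.seq (relabel 0 5) output))))))

/-- The quota of red vertices in the cluster `l`: the number of blue vertices in it divided by the
ratio of the colours, rounded up if `l` is in `U`. -/
def quota (A : ℕ → ℕ → ℕ) (n P : ℕ) (U : Finset ℕ) (l : ℕ) : ℕ :=
  Nat.count (fun u => A 0 u = 1 ∧ A 1 u = l) n / P + if l ∈ U then 1 else 0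

theorem fairClustering_runs {s : Store} {n p : ℕ} (hp : 2 ≤ p) (hn : s.var 0 = n)
    (h2 : s.var 2 = 0) (ha : ∀ a, 2 ≤ a → s.arr a = 0) (hcol : ∀ u < n, s.arr 0 u = 1 ∨ s.arr 0 u = 0)
    (hlab : ∀ u < n, s.arr 1 u < n)
    (hbal : Nat.count (fun u => s.arr 0 u = 1) n = p * Nat.count (fun u => s.arr 0 u = 0) n) :
    Runs fairClustering s (34 * n ^ 2 + 488 * n + 80) fun s' => ∃ (P : ℕ) (U : Finset ℕ) (L : ℕ → ℕ),
      2 ≤ P ∧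
      Nat.count (fun u => s.arr 0 u = 1) n = P * Nat.count (fun u => s.arr 0 u = 0) n ∧
      Greedy P (n + n) (fun l => Nat.count (fun u => s.arr 1 u = l) n)
        (fun l => Nat.count (fun u => s.arr 0 u = 1 ∧ s.arr 1 u = l) n % P) U ∧
      ∑ l ∈ Finset.range (n + n), quota s.arr n P U l = Nat.count (fun u => s.arr 0 u = 0) n ∧
      (∀ l, Nat.count (fun u => s.arr 0 u = 1 ∧ L u = l + 1) n = P * quota s.arr n P U l ∧
        Nat.count (fun u => s.arr 0 u = 1 ∧ s.arr 1 u = l ∧ L u = l + 1) n =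
          min (P * quota s.arr n P U l) (Nat.count (fun u => s.arr 0 u = 1 ∧ s.arr 1 u = l) n)) ∧
      (∀ l, Nat.count (fun u => s.arr 0 u = 0 ∧ L u = l + 1) n = quota s.arr n P U l ∧
        Nat.count (fun u => s.arr 0 u = 0 ∧ s.arr 1 u = l ∧ L u = l + 1) n =
          min (quota s.arr n P U l) (Nat.count (fun u => s.arr 0 u = 0 ∧ s.arr 1 u = l) n)) ∧
      (∀ u < n, 0 < L u ∧ L u ≤ n + n) ∧
      (∀ u < n, s'.arr 2 u < n) ∧
      ∀ u < n, ∀ v < n, s'.arr 2 u = s'.arr 2 v ↔ L u = L v := by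
  have hBR : Nat.count (fun u => s.arr 0 u = 1) n + Nat.count (fun u => s.arr 0 u = 0) n = n := by
    rw [Nat.count_eq_card_filter_range, Nat.count_eq_card_filter_range,
      ← Finset.card_union_of_disjoint, ← Finset.filter_or, Finset.filter_true_of_mem,
      Finset.card_range]
    · exact fun u hu => hcol u (Finset.mem_range.1 hu)
    · rw [Finset.disjoint_filter]; omega
  refine Runs.mono (T := n * 18 + 6 + (n * 12 + 14 + (n * 60 + 6 + (n * 13 + 8 +
    (n * (n * 34 + 38) + 6 + ((n * 35 + 6 + ((n + (n + n)) * 42 + 8)) +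
    ((n * 35 + 6 + ((n + (n + n)) * 42 + 8)) + (n * 12 + 6 + (n * 13 + 6))))))))) ?_
    (le_of_eq (by ring)) fun _ h => h
  set B := Nat.count (fun u => s.arr 0 u = 1) n with hB
  set R := Nat.count (fun u => s.arr 0 u = 0) n with hR
  refine Runs.seq (countBlue_runs hn h2) fun s₁ ⟨h₁, f₁⟩ => ?_
  have n₁ : s₁.var 0 = n := by
    rw [f₁.1 0 (by simp [countBlue, Program.KeepsVar, Program.for, Program.inc]), hn]
  have A₁ : s₁.arr = s.arr := funext fun a =>
    f₁.2 a (by simp [countBlue, Program.KeepsArr, Program.for, Program.inc])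
  rw [← hB] at h₁
  have hsub : s₁.var 0 - s₁.var 2 = R := by omega
  refine Runs.seq (computeRatio_runs (n := n) hp (by rw [hsub, h₁, hbal]) (by omega))
    fun s₂ ⟨⟨h₂, hP, hBP⟩, f₂⟩ => ?_
  rw [hsub] at h₂
  rw [h₁, h₂] at hBP
  have n₂ : s₂.var 0 = n := by
    rw [f₂.1 0 (by simp [computeRatio, Program.KeepsVar, Program.inc]), n₁]
  have A₂ : s₂.arr = s.arr := (funext fun a =>
    f₂.2 a (by simp [computeRatio, Program.KeepsArr, Program.inc])).trans A₁
  obtain ⟨P, hPdef⟩ : ∃ P, s₂.var 4 = P := ⟨_, rfl⟩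
  rw [hPdef] at hP hBP
  refine Runs.seq (countClusters_runs n₂ hPdef (by omega) (by rw [A₂, ha 3 (by norm_num)])
    (by rw [A₂, ha 4 (by norm_num)]) (by rw [A₂, ha 5 (by norm_num)])
    (by rw [A₂, ha 6 (by norm_num)])) fun s₃ ⟨h₃, f₃⟩ => ?_
  rw [A₂] at h₃
  have hb : ∀ l, s₃.arr 5 l = Nat.count (fun u => s.arr 0 u = 1 ∧ s.arr 1 u = l) n / P ∧
      s₃.arr 4 l = Nat.count (fun u => s.arr 0 u = 1 ∧ s.arr 1 u = l) n % P := fun l => by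
    obtain ⟨_, h, hlt, _⟩ := h₃ l
    rw [h, Nat.mul_add_div (by omega), Nat.mul_add_mod, Nat.div_eq_of_lt hlt, Nat.mod_eq_of_lt hlt]
    exact ⟨rfl, rfl⟩
  have hout : ∀ (r : ℕ → Prop) [DecidablePred r] (l : ℕ), n ≤ l →
      Nat.count (fun u => r u ∧ s.arr 1 u = l) n = 0 := fun r _ l hl => by
    rw [count_congr_of_lt (q := fun _ => False) fun u hu => by
      have := hlab u hu
      simp only [iff_false, not_and]; omega]
    simp
  have c₃ : s₃.arr 3 = fun l => Nat.count (fun u => s.arr 1 u = l) n := funext fun l => (h₃ l).1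
  have r₃ : s₃.arr 4 = fun l => Nat.count (fun u => s.arr 0 u = 1 ∧ s.arr 1 u = l) n % P :=
    funext fun l => (hb l).2
  have n₃ : s₃.var 0 = n := by
    rw [f₃.1 0 (by simp [countClusters, Program.KeepsVar, Program.for, Program.inc]), n₂]
  have R₃ : s₃.var 3 = R := by
    rw [f₃.1 3 (by simp [countClusters, Program.KeepsVar, Program.for, Program.inc]), h₂]
  have P₃ : s₃.var 4 = P := by
    rw [f₃.1 4 (by simp [countClusters, Program.KeepsVar, Program.for, Program.inc]), hPdef]
  have A₃ : ∀ a, a = 0 ∨ a = 1 ∨ 7 ≤ a → s₃.arr a = s.arr a := fun a h => by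
    rw [f₃.2 a (by simp [countClusters, Program.KeepsArr, Program.for, Program.inc]; omega), A₂]
  refine Runs.seq (computeMissing_runs n₃) fun s₄ ⟨h₄, f₄⟩ => ?_
  have n₄ : s₄.var 0 = n := by
    rw [f₄.1 0 (by simp [computeMissing, Program.KeepsVar, Program.for, Program.inc]), n₃]
  have P₄ : s₄.var 4 = P := by
    rw [f₄.1 4 (by simp [computeMissing, Program.KeepsVar, Program.for, Program.inc]), P₃]
  have A₄ : s₄.arr = s₃.arr := funext fun a =>
    f₄.2 a (by simp [computeMissing, Program.KeepsArr, Program.for, Program.inc])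
  rw [R₃] at h₄
  refine Runs.seq (roundUp_runs n₄ h₄ (by omega) (by rw [A₄, A₃ 7 (by omega), ha 7 (by norm_num)])
    (fun l hl => ?_) (fun l hl => ?_)) fun s₅ ⟨⟨U, hU, hgr, h₅⟩, f₅⟩ => ?_
  · rw [A₄, (h₃ l).1]
    simpa using hout (fun _ => True) l hl
  · rw [A₄, (hb l).2, hout _ l hl, Nat.zero_mod]
  rw [P₄, A₄] at h₅ hgr
  rw [c₃, r₃] at hgr
  have q₅ : ∀ l, s₅.arr 5 l = quota s.arr n P U l := fun l => by rw [(h₅ l).1, (hb l).1, quota]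
  have q₆ : ∀ l, s₅.arr 6 l = P * quota s.arr n P U l := fun l => by
    rw [← q₅, (h₅ l).1, (h₅ l).2, (h₃ l).2.2.2, mul_add]
    simp
  have n₅ : s₅.var 0 = n := by
    rw [f₅.1 0 (by simp [roundUp, findLargest, Program.KeepsVar, Program.for, Program.inc]), n₄]
  have A₅ : ∀ a, a = 0 ∨ a = 1 ∨ a = 8 → s₅.arr a = s.arr a := fun a h => by
    rw [f₅.2 a (by simp [roundUp, findLargest, Program.KeepsArr, Program.for, Program.inc]; omega),
      A₄, A₃ a (by omega)]
  have a₀ := A₅ 0 (by omega)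
  have a₁ := A₅ 1 (by omega)
  have a₈ : s₅.arr 8 = 0 := by rw [A₅ 8 (by omega), ha 8 (by norm_num)]
  have hquota : ∀ l, n + n ≤ l → quota s.arr n P U l = 0 := fun l hl => by
    have : l ∉ U := fun h => absurd (Finset.mem_range.1 (hgr.1 h)) (by omega)
    rw [quota, if_neg this, hout _ l (by omega), Nat.zero_div]
  have hsum : ∑ l ∈ Finset.range (n + n), quota s.arr n P U l = R := by
    -- This makes the truncated subtraction in `computeMissing` an honest difference, so the quotas
    -- add up to `R` exactly.
    have hle : ∑ l ∈ Finset.range n, s₃.arr 5 l ≤ R := by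
      refine Nat.le_of_mul_le_mul_left (c := P) ?_ (by omega)
      rw [← hBP, hB, ← sum_count_eq (f := s.arr 1) hlab, Finset.mul_sum]
      refine Finset.sum_le_sum fun l _ => ?_
      rw [(h₃ l).2.1]
      exact Nat.le_add_right _ _
    have heq : ∑ l ∈ Finset.range (n + n), s₃.arr 5 l = ∑ l ∈ Finset.range n, s₃.arr 5 l := by
      rw [Finset.sum_range_add, Nat.add_eq_left]
      refine Finset.sum_eq_zero fun l _ => ?_
      rw [(hb _).1, hout _ _ (Nat.le_add_right _ _), Nat.zero_div]
    simp only [quota, ← fun l => (hb l).1]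
    rw [Finset.sum_add_distrib, heq, ← Finset.sum_filter, Finset.filter_mem_eq_inter,
      Finset.inter_eq_right.2 hgr.1, Finset.sum_const, smul_eq_mul, mul_one, hU]
    omega
  refine Runs.seq (relabel_runs (N := n + n) (by norm_num) n₅
    (fun u hu => by rw [a₁]; exact (hlab u hu).trans_le (Nat.le_add_right _ _))
    (fun u _ _ => by simp [a₈]) (fun l hl => by rw [q₆, hquota l hl, mul_zero])
    (by simp only [q₆, a₀]; rw [← Finset.mul_sum, hsum, ← hBP])) fun s₆ ⟨⟨h₆, k₆, m₆, e₆⟩, f₆⟩ => ?_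
  have n₆ : s₆.var 0 = n := by
    rw [f₆.1 0 (by simp [relabel, keepLabels, fillQuotas, Program.KeepsVar, Program.for,
      Program.inc]), n₅]
  have A₆ : ∀ a, a = 0 ∨ a = 1 ∨ a = 5 → s₆.arr a = s₅.arr a := fun a h =>
    f₆.2 a (by simp [relabel, keepLabels, fillQuotas, Program.KeepsArr, Program.for, Program.inc]
               omega)
  have b₀ := (A₆ 0 (by omega)).trans a₀
  have b₁ := (A₆ 1 (by omega)).trans a₁
  have b₅ := A₆ 5 (by omega)
  simp only [a₀, a₁, q₆] at h₆ k₆ m₆ e₆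
  refine Runs.seq (relabel_runs (N := n + n) (by norm_num) n₆
    (fun u hu => by rw [b₁]; exact (hlab u hu).trans_le (Nat.le_add_right _ _))
    (fun u hu hx => by rw [e₆ u hu (by rw [← b₀]; omega), a₈]; rfl)
    (fun l hl => by rw [b₅, q₅, hquota l hl])
    (by simp only [b₅, q₅, b₀]; rw [hsum])) fun s₇ ⟨⟨h₇, k₇, m₇, e₇⟩, f₇⟩ => ?_
  have n₇ : s₇.var 0 = n := by
    rw [f₇.1 0 (by simp [relabel, keepLabels, fillQuotas, Program.KeepsVar, Program.for,
      Program.inc]), n₆]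
  simp only [b₀, b₁, b₅, q₅] at h₇ k₇ m₇ e₇
  -- The red pass leaves the blue labels alone, so the guarantees of both passes hold in the final
  -- memory.
  have hblue : ∀ u < n, s.arr 0 u = 1 → s₇.arr 8 u = s₆.arr 8 u := fun u hu h =>
    e₇ u hu (by omega)
  refine (output_runs n₇).mono le_rfl fun s' h₈ => ⟨P, U, s₇.arr 8, hP, hBP, hgr, hsum, fun l =>
    ⟨(count_congr_of_lt fun u hu => ?_).trans (h₆ l), (count_congr_of_lt fun u hu => ?_).trans
      (k₆ l)⟩, fun l => ⟨h₇ l, k₇ l⟩, fun u hu => ?_, h₈⟩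
  · exact and_congr_right fun h => by rw [hblue u hu h]
  · exact and_congr_right fun h => by rw [hblue u hu h]
  · rcases hcol u hu with h | h
    · rw [hblue u hu h]; exact m₆ u hu h
    · exact m₇ u hu h

end RAM

/-! ### Translation between labellings, fair clusterings and machine memory. -/

section Main

open Finset

theorem sameCluster_iff_part_eq {V : Type*} [Fintype V] [DecidableEq V] (C : Clustering V)
    (u v : V) : C.part u = C.part v ↔ SameCluster C u v := by
  constructor
  · intro h
    exact ⟨C.part v, C.part_mem.2 (mem_univ v), h ▸ C.mem_part (mem_univ u), C.mem_part (mem_univ v)⟩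
  · rintro ⟨S, hS, hu, hv⟩
    rw [C.part_eq_of_mem hS hu, C.part_eq_of_mem hS hv]

theorem exists_clustering_of_labels {n : ℕ} (lab : Fin n → Fin n) :
    ∃ F : Clustering (Fin n), Labels lab F := by
  classical
  refine ⟨Finpartition.ofSetoid (Setoid.ker lab), fun u v => ?_⟩
  rw [← sameCluster_iff_part_eq, ← Finpartition.mem_part_iff_part_eq_part _ (mem_univ u)
    (mem_univ v)]
  exact eq_comm.trans (Finpartition.mem_part_ofSetoid_iff_rel (s := Setoid.ker lab)).symm

theorem colourCount_part {V : Type*} [Fintype V] [DecidableEq V] (col : V → Colour)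
    (F : Clustering V) (x : Colour) (v : V) :
    colourCount col x (F.part v) = #{u | col u = x ∧ F.part u = F.part v} := by
  unfold colourCount
  congr 1
  ext u
  simp only [mem_filter, mem_univ, true_and]
  rw [and_comm, Finpartition.mem_part_iff_part_eq_part _ (mem_univ u) (mem_univ v)]

/-- The cross-multiplied ratio can be cancelled because a vertex exists, which forces a red vertex
in `V`. The same argument inside a cluster shows that it has a red vertex. -/
theorem IsFair.fairLabels {V : Type*} [Fintype V] [DecidableEq V] {col : V → Colour}
    {F : Clustering V} {P : ℕ} (h : IsFair col F)
    (hbal : #{v | col v = .blue} = P * #{v | col v = .red}) : FairLabels col P F.part := by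
  intro v
  have hv : v ∈ F.part v := F.mem_part (mem_univ v)
  have hf := h _ (F.part_mem.2 (mem_univ v)) .blue .red
  rw [colourCount_part, colourCount_part] at hf
  change _ * #{v | col v = .red} = _ * #{v | col v = .blue} at hf
  rw [hbal] at hf
  have hR : 0 < #{v | col v = .red} := by
    by_contra h0
    rw [not_lt, Nat.le_zero] at h0
    rw [h0, mul_zero] at hbal
    have : v ∈ (∅ : Finset V) := by
      cases hc : col v
      · rw [← card_eq_zero.1 h0]; simp [hc]
      · rw [← card_eq_zero.1 hbal]; simp [hc]
    simp at this
  have heq : #{u | col u = .blue ∧ F.part u = F.part v} =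
      P * #{u | col u = .red ∧ F.part u = F.part v} := by
    refine Nat.eq_of_mul_eq_mul_right hR ?_
    rw [hf]; ring
  refine ⟨heq, Nat.pos_of_ne_zero fun h0 => ?_⟩
  rw [h0, mul_zero] at heq
  have : v ∈ (∅ : Finset V) := by
    cases hc : col v
    · rw [← card_eq_zero.1 h0]; simp [hc]
    · rw [← card_eq_zero.1 heq]; simp [hc]
  simp at this

/-- Distances are natural numbers, so one fair clustering, here the output of the algorithm, already
guarantees an optimal one. -/
theorem exists_isClosestFair {V : Type*} [Fintype V] [DecidableEq V] {col : V → Colour}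
    (C : Clustering V) {F : Clustering V} (h : IsFair col F) : ∃ Fopt, IsClosestFair col C Fopt := by
  obtain ⟨G, hG, hmin⟩ := (measure (clusterDist C)).wf.has_min {G | IsFair col G} ⟨F, h⟩
  exact ⟨G, hG, fun F' hF' => not_lt.1 (hmin F' hF')⟩

/-- The clusters of a clustering with labels `h` have the ratio of the colours `P : 1`. -/
theorem isFair_of_card_eq {V α : Type*} [Fintype V] [DecidableEq V] [DecidableEq α]
    {col : V → Colour} {F : Clustering V} {P : ℕ} {h : V → α} {k : α → ℕ}
    (hF : ∀ u v, h u = h v ↔ SameCluster F u v)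
    (hbal : #{v | col v = .blue} = P * #{v | col v = .red})
    (hblue : ∀ i, #{v | col v = .blue ∧ h v = i} = P * k i)
    (hred : ∀ i, #{v | col v = .red ∧ h v = i} = k i) : IsFair col F := by
  intro S hS
  obtain ⟨v, hv⟩ := F.nonempty_of_mem_parts hS
  obtain rfl : F.part v = S := F.part_eq_of_mem hS hv
  have hb : colourCount col .blue (F.part v) = P * k (h v) := by
    rw [colourCount_part, ← hblue]
    refine congrArg card (filter_congr fun u _ => and_congr_right fun _ => ?_)
    rw [sameCluster_iff_part_eq, hF]
  have hr : colourCount col .red (F.part v) = k (h v) := by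
    rw [colourCount_part, ← hred]
    refine congrArg card (filter_congr fun u _ => and_congr_right fun _ => ?_)
    rw [sameCluster_iff_part_eq, hF]
  have hbal' : colourCount col .blue univ = P * colourCount col .red univ := hbal
  rintro (_ | _) (_ | _)
  · rfl
  · rw [hb, hr, hbal']; ring
  · rw [hb, hr, hbal']; ring
  · rfl

theorem inputStore_colour {n : ℕ} (col : Fin n → Colour) (lab : Fin n → Fin n) (v : Fin n) :
    ((inputStore col lab).arr 0 v = 1 ↔ col v = .blue) ∧
      ((inputStore col lab).arr 0 v = 0 ↔ col v = .red) := by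
  cases hc : col v <;> simp [inputStore, hc]

theorem inputStore_label {n : ℕ} (col : Fin n → Colour) (lab : Fin n → Fin n) (v : Fin n) :
    (inputStore col lab).arr 1 v = lab v := by
  simp [inputStore]

end Main

theorem mainTheorem4 :
    ∃ (A : RAM.Program) (q : Polynomial ℕ),
      ∀ (p : ℕ), 1 < p →
      ∀ (n : ℕ) (col : Fin n → Colour),
        colourCount col Colour.blue Finset.univ = p * colourCount col Colour.red Finset.univ →
      ∀ (C : Clustering (Fin n)) (lab : Fin n → Fin n), Labels lab C →
        ∃ (t : ℕ) (s : RAM.Store) (F : Clustering (Fin n)),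
          RAM.Exec A (inputStore col lab) t s ∧ t ≤ q.eval n ∧
          Outputs s F ∧ IsCloseFair 17 col C F := by
  refine ⟨RAM.fairClustering, 34 * Polynomial.X ^ 2 + 488 * Polynomial.X + 80, ?_⟩
  intro p hp n col hbal C lab hlab
  set I := inputStore col lab with hI
  have hc := inputStore_colour col lab
  have hl := inputStore_label col lab
  rw [← hI] at hc hl
  -- conversion between the vertices and the cells of the arrays
  have cB : ∀ (r : ℕ → Prop) [DecidablePred r],
      (Finset.univ.filter fun v : Fin n => col v = .blue ∧ r v).card =
        Nat.count (fun u => I.arr 0 u = 1 ∧ r u) n := fun r _ => by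
    rw [← card_filter_fin]
    simp only [hc]
  have cR : ∀ (r : ℕ → Prop) [DecidablePred r],
      (Finset.univ.filter fun v : Fin n => col v = .red ∧ r v).card =
        Nat.count (fun u => I.arr 0 u = 0 ∧ r u) n := fun r _ => by
    rw [← card_filter_fin]
    simp only [hc]
  have cB' : (Finset.univ.filter fun v : Fin n => col v = .blue).card =
      Nat.count (fun u => I.arr 0 u = 1) n := by simpa using cB fun _ => True
  have cR' : (Finset.univ.filter fun v : Fin n => col v = .red).card =
      Nat.count (fun u => I.arr 0 u = 0) n := by simpa using cR fun _ => True
  obtain ⟨t, s, hexec, ht, P, U, L, hP, hBP, hgr, hsum, hblue, hred, hL, hout, hsame⟩ :=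
    RAM.fairClustering_runs (s := I) (n := n) (p := p) hp rfl rfl
      (fun a ha => by
        funext i
        have h0 : a ≠ 0 := by omega
        have h1 : a ≠ 1 := by omega
        simp [hI, inputStore, h0, h1])
      (fun u hu => by
        rw [(hc ⟨u, hu⟩).1, (hc ⟨u, hu⟩).2]
        cases col ⟨u, hu⟩ <;> simp)
      (fun u hu => by rw [hl ⟨u, hu⟩]; exact (lab ⟨u, hu⟩).2)
      (by rw [← cB', ← cR']; exact hbal)
  let f : Fin n → ℕ := fun v => lab v
  -- The machine stores labels increased by one, with 0 for unlabelled; `hL` says that no 0 remains,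
  -- so nothing is lost by the subtraction.
  let h : Fin n → ℕ := fun v => L v - 1
  let k : ℕ → ℕ := RAM.quota I.arr n P U
  have hf : ∀ (v : Fin n) i, f v = i ↔ I.arr 1 v = i := fun v i => by rw [hl]
  have hh : ∀ (v : Fin n) i, h v = i ↔ L v = i + 1 := fun v i => by
    have := (hL v v.2).1
    simp only [h]; omega
  have hbal' : (Finset.univ.filter fun v => col v = .blue).card =
      P * (Finset.univ.filter fun v => col v = .red).card := by rw [cB', cR']; exact hBP
  have hbi : ∀ i, (Finset.univ.filter fun v => col v = .blue ∧ f v = i).card =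
      Nat.count (fun u => I.arr 0 u = 1 ∧ I.arr 1 u = i) n := fun i => by
    simp only [hf]; exact cB fun u => I.arr 1 u = i
  have hci : ∀ i, (Finset.univ.filter fun v => f v = i).card =
      Nat.count (fun u => I.arr 1 u = i) n := fun i => by
    rw [← card_filter_fin]; simp only [hf]
  have hk : ∀ i, (Finset.univ.filter fun v => col v = .blue ∧ f v = i).card / P +
      (if i ∈ U then 1 else 0) = k i := fun i => by rw [hbi]; rfl
  have fillB : Fills col .blue f h fun i => P * k i := fun i => by
    simp only [hf, hh]
    exact ⟨(cB fun u => L u = i + 1).trans (hblue i).1,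
      ((cB fun u => I.arr 1 u = i ∧ L u = i + 1).trans (hblue i).2).trans
        (by rw [cB fun u => I.arr 1 u = i])⟩
  have fillR : Fills col .red f h k := fun i => by
    simp only [hf, hh]
    exact ⟨(cR fun u => L u = i + 1).trans (hred i).1,
      ((cR fun u => I.arr 1 u = i ∧ L u = i + 1).trans (hred i).2).trans
        (by rw [cR fun u => I.arr 1 u = i])⟩
  let out : Fin n → Fin n := fun v => ⟨s.arr 2 v, hout v v.2⟩
  obtain ⟨F, hF⟩ := exists_clustering_of_labels out
  have hhF : ∀ u v, h u = h v ↔ SameCluster F u v := fun u v => by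
    rw [← hF u v, Fin.ext_iff]
    have h1 := (hL u u.2).1
    have h2 := (hL v v.2).1
    rw [hsame u u.2 v v.2]
    simp only [h]; omega
  have hfair : IsFair col F := isFair_of_card_eq hhF hbal' (fun i => (fillB i).1)
    fun i => (fillR i).1
  obtain ⟨Fopt, hopt⟩ := exists_isClosestFair C hfair
  refine ⟨t, s, F, hexec, by simpa using ht, ⟨out, fun _ => rfl, hF⟩, hfair, Fopt, hopt, ?_⟩
  have hfC : ∀ u v, f u = f v ↔ SameCluster C u v := fun u v => by
    rw [← hlab u v, Fin.ext_iff]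
  have hmain : disagreement f h ≤ 17 * disagreement f Fopt.part := by
    -- The bound is applied with the ratio `P` found by the machine, and with `n + n` labels to make
    -- room for the new clusters.
    refine disagreement_fill_le (N := n + n) (U := U) hP
      (fun v => (lab v).2.trans_le (Nat.le_add_right _ _)) (fun v => ?_) hbal' ?_ ?_ ?_ ?_
      (hopt.1.fairLabels hbal')
    · have := hL v v.2
      simp only [h]; omega
    · simpa only [hbi, hci] using hgr
    · simp only [hk, cR']; exact hsum
    · simpa only [hk] using fillB
    · simpa only [hk] using fillR
  rw [← two_mul_clusterDist hfC hhF, ← two_mul_clusterDist hfC (sameCluster_iff_part_eq Fopt)]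
    at hmain
  have : clusterDist C F ≤ 17 * clusterDist C Fopt := by omega
  exact_mod_cast this
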